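/- **Setting.** Let $G$ be a locally compact (Hausdorff) group with right Haar measure $\mu$ and let $H$ be a compact subgroup of $G$ with right Haar measure $\eta$. Let $\nu$ be the right $G$-invariant Radon measure on $H\backslash G$ satisfying Weil's formula $$\int_G f\,d\mu=\int_{H\backslash G}\int_H f(hy)\,d\eta(h)\,d\nu(Hy)\qquad (f\in C_c(G)).$$ **Hecke pairs.** For a closed subgroup $H\le G$ (with such a $\nu$), let $\mathcal H(G,H)$ be the space of all $f\in C_c(H\backslash G)$ with $f(Hxh)=f(Hx)$ for all $x\in G$, $h\in H$. Put $$(f*\xi)(Hx)=\int_{H\backslash G}f(Hxy^{-1})\,\xi(Hy)\,d\nu(Hy),\qquad \lambda(f)\xi=f*\xi .$$ If $H\backslash G$ is discrete, $(G,H)$ is a *Hecke pair* if $[H:H\cap xHx^{-1}]<\infty$ for all $x\in G$. If $H\backslash G$ is not discrete, $(G,H)$ is a *Hecke pair* if $\Delta_G|_H=\Delta_H=1$, the map $\lambda:\mathcal H(G,H)\to B(L^2(H\backslash G,\nu))$ is a well-defined algebra homomorphism, and for every $Hx\in H\backslash G$ there is $f\in\mathcal H(G,H)$ with $f(Hx)\ne0$.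 **Length functions.** A *length function* on $G$ is a Borel function $l:G\to[0,\infty)$ with $l(e)=0$, $l(g)=l(g^{-1})$ and $l(gh)\le l(g)+l(h)$ for all $g,h\in G$. It is *locally bounded* on $G$ if it is bounded on every compact subset of $G$. A length function on $(G,H)$ is a length function on $G$ that vanishes on $H$. It then induces a function on $H\backslash G$, and it is *locally bounded* on $(G,H)$ if this function is bounded on every compact subset of $H\backslash G$. **Property (RD).** The Hecke pair $(G,H)$ has *property (RD)* if there are a locally bounded length function $l$ on $(G,H)$ and real numbers $s,c>0$ such that $$\|\lambda(f)\|\le c\left(\int_{H\backslash G}|f(Hx)|^2(1+l(x))^{2s}\,d\nu(Hx)\right)^{1/2}\qquad\text{for all } f\in\mathcal H(G,H).$$ The group $G$ has *property (RD)* if there are a locally bounded length function $l$ on $G$ and real numbers $s,c>0$ such that, for all $f\in C_c(G)$, the operator $\lambda(f)\xi(x)=\int_G f(xy^{-1})\xi(y)\,d\mu(y)$ on $L^2(G,\mu)$ satisfies $$\|\lambda(f)\|\le c\left(\int_G|f(x)|^2(1+l(x))^{2s}\,d\mu(x)\right)^{1/2}.$$ **Theorem.** Let $H$ be a compact subgroup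 of a locally compact group $G$. Then $(G,H)$ is a Hecke pair, and $G$ has property (RD) if and only if the Hecke pair $(G,H)$ has property (RD). -/

import Mathlib

open MeasureTheory Topology

noncomputable section

namespace HeckePair

variable {G : Type*} [Group G]

/-! ## The homogeneous space of right cosets -/

/-- The space `H \ G` of right cosets `Hx`. -/
def CosetSpace (H : Subgroup G) : Type _ := Quotient (QuotientGroup.rightRel H)

namespace CosetSpace

variable (H : Subgroup G)

/-- The right coset `Hx`. -/
def mk (x : G) : CosetSpace H := Quotient.mk (QuotientGroup.rightRel H) x

variable {H}

theorem mk_mul_left {h : G} (hh : h ∈ H) (x : G) : mk H (h * x) = mk H x :=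
  Quotient.sound (QuotientGroup.rightRel_apply.mpr (by simpa using H.inv_mem hh))

/-- Right translation `Hx ↦ Hxg` on `H \ G`. -/
def mulRight (g : G) : CosetSpace H → CosetSpace H :=
  Quotient.lift (fun x => mk H (x * g)) (by
    intro x y hxy
    have hmem : y * x⁻¹ ∈ H := QuotientGroup.rightRel_apply.mp hxy
    have hy : y * g = (y * x⁻¹) * (x * g) := by group
    change mk H (x * g) = mk H (y * g)
    rw [hy, mk_mul_left hmem])

/-- `H \ G` carries the quotient topology. -/
instance [TopologicalSpace G] : TopologicalSpace (CosetSpace H) :=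
  inferInstanceAs (TopologicalSpace (Quotient (QuotientGroup.rightRel H)))

/-- `H \ G` carries the Borel sigma-algebra of the quotient topology. -/
instance [TopologicalSpace G] : MeasurableSpace (CosetSpace H) := borel _

instance [TopologicalSpace G] : BorelSpace (CosetSpace H) := ⟨rfl⟩

end CosetSpace

open _root_.HeckePair.CosetSpace

/-! ## Length functions -/

/-- A length function on `G`: a Borel function `l : G → [0, ∞)` with `l e = 0`,
`l g = l g⁻¹` and `l (g h) ≤ l g + l h`. -/
structure LengthFunction (G : Type*) [Group G] [MeasurableSpace G] where
  toFun : G → ℝ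
  measurable' : Measurable toFun
  nonneg' : ∀ g, 0 ≤ toFun g
  one' : toFun 1 = 0
  inv' : ∀ g, toFun g⁻¹ = toFun g
  mul_le' : ∀ g h, toFun (g * h) ≤ toFun g + toFun h

/-- A length function on the pair `(G, H)`: a length function on `G` whose kernel contains `H`. -/
structure PairLengthFunction [MeasurableSpace G] (H : Subgroup G) extends LengthFunction G where
  kernel' : ∀ h ∈ H, toFun h = 0

theorem PairLengthFunction.mul_left_eq [MeasurableSpace G] {H : Subgroup G}
    (l : PairLengthFunction H) {h : G} (hh : h ∈ H) (x : G) : l.toFun (h * x) = l.toFun x := by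
  have h1 := l.mul_le' h x
  have h2 := l.mul_le' h⁻¹ (h * x)
  rw [l.kernel' h hh] at h1
  rw [l.kernel' h⁻¹ (H.inv_mem hh), inv_mul_cancel_left] at h2
  linarith

/-- The function `Hx ↦ l x` on `H \ G` induced by a length function on `(G, H)`. -/
def PairLengthFunction.onCosets [MeasurableSpace G] {H : Subgroup G}
    (l : PairLengthFunction H) : CosetSpace H → ℝ :=
  Quotient.lift l.toFun (by
    intro x y hxy
    have hmem : y * x⁻¹ ∈ H := QuotientGroup.rightRel_apply.mp hxy
    rw [← l.mul_left_eq hmem x, inv_mul_cancel_right])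

/-- A length function on `G` is locally bounded if it is bounded on compact subsets of `G`. -/
def LengthFunction.LocallyBounded [TopologicalSpace G] [MeasurableSpace G]
    (l : LengthFunction G) : Prop :=
  ∀ K : Set G, IsCompact K → BddAbove (l.toFun '' K)

/-- A length function on `(G, H)` is locally bounded if it is bounded on compact subsets of
`H \ G`. -/
def PairLengthFunction.LocallyBoundedOnCosets [TopologicalSpace G] [MeasurableSpace G]
    {H : Subgroup G} (l : PairLengthFunction H) : Prop :=
  ∀ K : Set (CosetSpace H), IsCompact K → BddAbove (l.onCosets '' K)

/-! ## Property (RD) for groups -/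

section GroupRD

variable [TopologicalSpace G] [MeasurableSpace G]

/-- `T` is the operator `λ(f) : ξ ↦ f ∗ ξ` on `L²(G, μ)`, where
`(f ∗ ξ)(x) = ∫ f(x y⁻¹) ξ(y) dμ(y)`. -/
def IsGroupConvolutionOperator (μ : Measure G) (f : G → ℂ)
    (T : Lp ℂ 2 μ →L[ℂ] Lp ℂ 2 μ) : Prop :=
  ∀ ξ : Lp ℂ 2 μ,
    (∀ᵐ x ∂μ, Integrable (fun y => f (x * y⁻¹) * ξ y) μ) ∧
    T ξ =ᵐ[μ] fun x => ∫ y, f (x * y⁻¹) * ξ y ∂μ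

/-- The weighted norm `‖f‖_{s,l} = (∫_G |f|² (1 + l)^{2s} dμ)^{1/2}`. -/
def groupWeightedNorm (μ : Measure G) (l : LengthFunction G) (s : ℝ) (f : G → ℂ) : ℝ :=
  Real.sqrt (∫ x, ‖f x‖ ^ 2 * (1 + l.toFun x) ^ (2 * s) ∂μ)

/-- Property (RD) of the locally compact group `G` with right Haar measure `μ`. -/
def GroupHasRD (μ : Measure G) : Prop :=
  ∃ l : LengthFunction G, l.LocallyBounded ∧ ∃ s c : ℝ, 0 < s ∧ 0 < c ∧
    ∀ f : G → ℂ, Continuous f → HasCompactSupport f →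
      ∃ T : Lp ℂ 2 μ →L[ℂ] Lp ℂ 2 μ, IsGroupConvolutionOperator μ f T ∧
        ‖T‖ ≤ c * groupWeightedNorm μ l s f

end GroupRD

/-! ## The invariant measure on `H \ G` -/

section Weil

variable [TopologicalSpace G] [IsTopologicalGroup G] [MeasurableSpace G] [BorelSpace G]

theorem integral_mul_left_eq {H : Subgroup G} (η : Measure H) [η.IsMulRightInvariant]
    (f : G → ℂ) {k : G} (hk : k ∈ H) (x : G) :
    ∫ h : H, f (h * (k * x)) ∂η = ∫ h : H, f (h * x) ∂η := by
  have key := integral_mul_right_eq_self (μ := η) (fun h : H => f (h * x)) ⟨k, hk⟩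
  simpa [mul_assoc] using key

/-- The function `Hx ↦ ∫_H f(h x) dη(h)` on `H \ G`. -/
def orbitIntegral {H : Subgroup G} (η : Measure H) [η.IsMulRightInvariant] (f : G → ℂ) :
    CosetSpace H → ℂ :=
  Quotient.lift (fun x => ∫ h : H, f (h * x) ∂η) (by
    intro x y hxy
    have hmem : y * x⁻¹ ∈ H := QuotientGroup.rightRel_apply.mp hxy
    have key := integral_mul_left_eq η f hmem x
    rw [inv_mul_cancel_right] at key
    exact key.symm)

/-- `ν` is a right `G`-invariant measure on `H \ G` for which Weil's formula
`∫_G f dμ = ∫_{H \ G} ∫_H f(h y) dη(h) dν(Hy)` holds for all `f ∈ C_c(G)`. -/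
structure IsWeilMeasure {H : Subgroup G} (μ : Measure G) (η : Measure H)
    [η.IsMulRightInvariant] (ν : Measure (CosetSpace H)) : Prop where
  map_mulRight : ∀ g : G, ν.map (CosetSpace.mulRight g) = ν
  weil : ∀ f : G → ℂ, Continuous f → HasCompactSupport f →
    ∫ x, f x ∂μ = ∫ q, orbitIntegral η f q ∂ν

end Weil

/-! ## Hecke algebra, Hecke pairs and property (RD) for pairs -/

section Pair

variable [TopologicalSpace G]

/-- The Hecke algebra `ℋ(G, H)` as a vector space: the continuous compactly supported complex
functions `f` on `H \ G` with `f(Hxh) = f(Hx)` for all `x ∈ G`, `h ∈ H`. -/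
def heckeAlgebra (H : Subgroup G) : Submodule ℂ (CosetSpace H → ℂ) where
  carrier := {f | Continuous f ∧ HasCompactSupport f ∧
    ∀ x : G, ∀ h ∈ H, f (mk H (x * h)) = f (mk H x)}
  zero_mem' := ⟨continuous_zero, HasCompactSupport.zero, fun _ _ _ => rfl⟩
  add_mem' := by
    rintro f g ⟨hf, hf', hf''⟩ ⟨hg, hg', hg''⟩
    refine ⟨hf.add hg, hf'.add hg', fun x h hh => ?_⟩
    simp [hf'' x h hh, hg'' x h hh]
  smul_mem' := by
    rintro c f ⟨hf, hf', hf''⟩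
    refine ⟨hf.const_smul c, hf'.smul_left (f := fun _ => c), fun x h hh => ?_⟩
    simp [hf'' x h hh]

/-- The kernel `(Hx, Hy) ↦ f(H x y⁻¹)` on `H \ G × H \ G` for `f ∈ ℋ(G, H)`. -/
def convolutionKernel {H : Subgroup G} (f : heckeAlgebra H) :
    CosetSpace H → CosetSpace H → ℂ :=
  Quotient.lift₂ (fun x y => f.1 (mk H (x * y⁻¹))) (by
    intro x y x' y' hx hy
    have hx' : x' * x⁻¹ ∈ H := QuotientGroup.rightRel_apply.mp hx
    have hy' : y' * y⁻¹ ∈ H := QuotientGroup.rightRel_apply.mp hy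
    have e : x' * y'⁻¹ = (x' * x⁻¹) * ((x * y⁻¹) * (y' * y⁻¹)⁻¹) := by group
    change f.1 (mk H (x * y⁻¹)) = f.1 (mk H (x' * y'⁻¹))
    rw [e, mk_mul_left hx', f.2.2.2 _ _ (H.inv_mem hy')])

/-- `T` is the operator `λ(f) : ξ ↦ f ∗ ξ` on `L²(H \ G, ν)`, where
`(f ∗ ξ)(Hx) = ∫ f(H x y⁻¹) ξ(Hy) dν(Hy)`. -/
def IsConvolutionOperator {H : Subgroup G} (ν : Measure (CosetSpace H)) (f : heckeAlgebra H)
    (T : Lp ℂ 2 ν →L[ℂ] Lp ℂ 2 ν) : Prop :=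
  ∀ ξ : Lp ℂ 2 ν,
    (∀ᵐ p ∂ν, Integrable (fun q => convolutionKernel f p q * ξ q) ν) ∧
    T ξ =ᵐ[ν] fun p => ∫ q, convolutionKernel f p q * ξ q ∂ν

/-- `p = f ∗ g` in `ℋ(G, H)`. -/
def IsHeckeProduct {H : Subgroup G} (ν : Measure (CosetSpace H)) (f g p : heckeAlgebra H) :
    Prop :=
  ∀ a, Integrable (fun q => convolutionKernel f a q * g.1 q) ν ∧
    p.1 a = ∫ q, convolutionKernel f a q * g.1 q ∂ν

/-- `λ : ℋ(G, H) → B(L²(H \ G))` is a well defined homomorphism: the convolution product stays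
in `ℋ(G, H)`, every `λ(f)` is a bounded operator, and `f ↦ λ(f)` is linear and multiplicative. -/
def RegularRepresentationWellDefined {H : Subgroup G} (ν : Measure (CosetSpace H)) : Prop :=
  ∃ lam : heckeAlgebra H →ₗ[ℂ] (Lp ℂ 2 ν →L[ℂ] Lp ℂ 2 ν),
    (∀ f, IsConvolutionOperator ν f (lam f)) ∧
    ∀ f g, ∃ p, IsHeckeProduct ν f g p ∧ lam p = (lam f).comp (lam g)

/-- `(G, H)` is a Hecke pair (with respect to the measure `ν` on `H \ G`). If `H \ G` is discrete
this means `[H : H ∩ xHx⁻¹] < ∞` for all `x`; otherwise it means that the modular functions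
of `G` (on `H`) and of `H` are trivial, that the left regular representation of `ℋ(G, H)` is a
well defined homomorphism, and that for each `Hx` some `f ∈ ℋ(G, H)` has `f(Hx) ≠ 0`. -/
structure IsHeckePair [IsTopologicalGroup G] [LocallyCompactSpace G]
    (H : Subgroup G) [LocallyCompactSpace H] (ν : Measure (CosetSpace H)) : Prop where
  isClosed : IsClosed (H : Set G)
  of_discrete : DiscreteTopology (CosetSpace H) →
    ∀ x : G, (H.map (MulAut.conj x).toMonoidHom).relIndex H ≠ 0
  modular_eq_one : ¬ DiscreteTopology (CosetSpace H) →
    ∀ h : H, Measure.modularCharacter (h : G) = 1 ∧ Measure.modularCharacter h = 1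
  regularRepresentation : ¬ DiscreteTopology (CosetSpace H) →
    RegularRepresentationWellDefined ν
  nondegenerate : ¬ DiscreteTopology (CosetSpace H) →
    ∀ a : CosetSpace H, ∃ f : heckeAlgebra H, f.1 a ≠ 0

variable [MeasurableSpace G]

/-- The weighted norm `‖f‖_{s,l} = (∫_{H \ G} |f|² (1 + l)^{2s} dν)^{1/2}`. -/
def weightedNorm {H : Subgroup G} (ν : Measure (CosetSpace H)) (l : PairLengthFunction H)
    (s : ℝ) (f : heckeAlgebra H) : ℝ :=
  Real.sqrt (∫ q, ‖f.1 q‖ ^ 2 * (1 + l.onCosets q) ^ (2 * s) ∂ν)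

/-- Property (RD) of the pair `(G, H)` with invariant measure `ν` on `H \ G`. -/
def PairHasRD {H : Subgroup G} (ν : Measure (CosetSpace H)) : Prop :=
  ∃ l : PairLengthFunction H, l.LocallyBoundedOnCosets ∧ ∃ s c : ℝ, 0 < s ∧ 0 < c ∧
    ∀ f : heckeAlgebra H,
      ∃ T : Lp ℂ 2 ν →L[ℂ] Lp ℂ 2 ν, IsConvolutionOperator ν f T ∧
        ‖T‖ ≤ c * weightedNorm ν l s f

end Pair

end HeckePair

end

/-! Let m = η(H), which is finite and positive because H is compact. Testing Weil's formula on
functions lifted from H\G shows that μ pushes forward to m·ν. Functions on H\G are thus the left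
H-invariant functions on G, with integrals scaled by m, and f ∈ ℋ(G,H) lifts to a bi-invariant
element of C_c(G) whose convolution operator, applied to lifted functions, is m times the lift of
λ(f). All analysis on H\G can therefore be done on G.

Hecke pair: if H\G is discrete then H is compact open and the indices are finite. In general a
compact group has no nontrivial positive scaling of a set of finite nonzero Haar measure, so the
modular characters are trivial on H. Schur's test on G bounds λ(f), Fubini makes λ multiplicative,
and averaging a bump function over H on both sides gives an element of ℋ(G,H) that is nonzero at a
given coset.

(RD) passes from G to the pair by restricting to lifted functions
(`IsWeilMeasure.kernelBound_convolutionKernel`). The length function must be changed, since it need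
not vanish on H. It is thickened by an H-invariant relatively compact open set, shifted to stay
subadditive and set to 0 on H (`LengthFunction.exists_pairLengthFunction`). This changes it only by
a bounded amount.

(RD) passes from the pair to G with the same length function. For F in C_c(G), replace |F| by its
quadratic mean over H on both sides, which lies in ℋ(G,H). Quadratic means multiply an L² norm with
H-invariant weight by an exact constant. Cauchy–Schwarz and Minkowski over H show that averaging the
factors only enlarges a convolution of nonnegative functions, up to the matching power of m
(`integral_kernelIntegral_sq_le`). A bound for the mean is hence a bound for λ(F)
(`IsWeilMeasure.kernelBound_of_mean`).

G need not be σ-compact or second countable. Fubini is therefore used only for compactly supported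
continuous integrands, and operator bounds are proved on C_c and then extended to L². -/

noncomputable section

set_option linter.unusedSectionVars false

namespace HeckePair

/-! ### Integral operators with proper continuous kernels on L² -/

section

open Filter Function Set
open scoped ENNReal

section Analysis

variable {X : Type*} [TopologicalSpace X] [MeasurableSpace X] [BorelSpace X]

/-- The Cauchy–Schwarz inequality for real integrals. -/
theorem sq_integral_mul_le {X : Type*} [MeasurableSpace X] {μ : Measure X} {u v : X → ℝ}
    (hu : Integrable (fun x => u x ^ 2) μ) (hv : Integrable (fun x => v x ^ 2) μ)
    (huv : Integrable (fun x => u x * v x) μ) :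
    (∫ x, u x * v x ∂μ) ^ 2 ≤ (∫ x, u x ^ 2 ∂μ) * ∫ x, v x ^ 2 ∂μ := by
  -- The quadratic polynomial t ↦ ∫ (u + t v)² is nonnegative, so its discriminant is nonpositive.
  have key : ∀ t : ℝ, 0 ≤ (∫ x, v x ^ 2 ∂μ) * (t * t) + (2 * ∫ x, u x * v x ∂μ) * t
      + ∫ x, u x ^ 2 ∂μ := by
    intro t
    have h : 0 ≤ ∫ x, (u x + t * v x) ^ 2 ∂μ := integral_nonneg fun x => sq_nonneg _
    have e : (fun x => (u x + t * v x) ^ 2) =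
        fun x => (t * t) * v x ^ 2 + (2 * t) * (u x * v x) + u x ^ 2 := by
      funext x; ring
    have h2 : ∫ x, ((t * t) * v x ^ 2 + (2 * t) * (u x * v x) + u x ^ 2) ∂μ =
        t * t * (∫ x, v x ^ 2 ∂μ) + 2 * t * (∫ x, u x * v x ∂μ) + ∫ x, u x ^ 2 ∂μ := by
      have i1 := hv.const_mul (t * t)
      have i2 := huv.const_mul (2 * t)
      have i3 : Integrable (fun x => t * t * v x ^ 2 + 2 * t * (u x * v x)) μ := i1.add i2
      rw [integral_add i3 hu, integral_add i1 i2, integral_const_mul, integral_const_mul]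
    rw [e, h2] at h
    linarith
  have := discrim_le_zero key
  unfold discrim at this
  nlinarith

theorem sq_integral_mul_le_of_continuous {μ : Measure X} [IsFiniteMeasureOnCompacts μ]
    {u v : X → ℝ} (hu : Continuous u) (hu' : HasCompactSupport u) (hv : Continuous v)
    (hv' : HasCompactSupport v) :
    (∫ x, u x * v x ∂μ) ^ 2 ≤ (∫ x, u x ^ 2 ∂μ) * ∫ x, v x ^ 2 ∂μ :=
  sq_integral_mul_le
    ((hu.pow 2).integrable_of_hasCompactSupport (by simpa only [sq] using hu'.mul_left))
    ((hv.pow 2).integrable_of_hasCompactSupport (by simpa only [sq] using hv'.mul_left))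
    ((hu.mul hv).integrable_of_hasCompactSupport hv'.mul_left)

theorem integrable_norm_sq {μ : Measure X} [IsFiniteMeasureOnCompacts μ]
    {u : X → ℂ} (hu : Continuous u) (hu' : HasCompactSupport u) :
    Integrable (fun x => ‖u x‖ ^ 2) μ :=
  (hu.norm.pow 2).integrable_of_hasCompactSupport
    (by simpa only [sq] using hu'.norm.mul_left)

/-- A continuous function `k` on `X × X` with both projections proper on its support. -/
structure IsProperKernel {E : Type*} [TopologicalSpace E] [Zero E] (k : X → X → E) : Prop where
  continuous : Continuous (uncurry k)
  left : ∀ K : Set X, IsCompact K → ∃ L : Set X, IsCompact L ∧ ∀ x ∈ K, ∀ y ∉ L, k x y = 0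
  right : ∀ K : Set X, IsCompact K → ∃ L : Set X, IsCompact L ∧ ∀ y ∈ K, ∀ x ∉ L, k x y = 0

/-- The function `x ↦ ∫ k(x, y) ξ(y) dμ(y)`. -/
def kernelIntegral {E : Type*} [NormedRing E] [NormedSpace ℝ E] (μ : Measure X) (k : X → X → E)
    (ξ : X → E) (x : X) : E := ∫ y, k x y * ξ y ∂μ

/-- `‖K ξ‖₂ ≤ C ‖ξ‖₂` for all continuous compactly supported `ξ`. -/
def KernelBound (μ : Measure X) (k : X → X → ℂ) (C : ℝ) : Prop :=
  ∀ ξ : X → ℂ, Continuous ξ → HasCompactSupport ξ →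
    ∫ x, ‖kernelIntegral μ k ξ x‖ ^ 2 ∂μ ≤ C ^ 2 * ∫ x, ‖ξ x‖ ^ 2 ∂μ

/-- `T` is the integral operator with kernel `k` on `L²(X, μ)`. -/
def IsKernelOperator (μ : Measure X) (k : X → X → ℂ) (T : Lp ℂ 2 μ →L[ℂ] Lp ℂ 2 μ) : Prop :=
  ∀ ξ : Lp ℂ 2 μ,
    (∀ᵐ x ∂μ, Integrable (fun y => k x y * ξ y) μ) ∧
    T ξ =ᵐ[μ] fun x => ∫ y, k x y * ξ y ∂μ

namespace IsProperKernel

section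

variable {E : Type*} [NormedRing E] {k : X → X → E}

theorem continuous_section (hk : IsProperKernel k) (x : X) : Continuous (k x) :=
  hk.continuous.comp (Continuous.prodMk_right x)

theorem hasCompactSupport_section [T2Space X] (hk : IsProperKernel k) (x : X) :
    HasCompactSupport (k x) := by
  obtain ⟨L, hL, h⟩ := hk.left {x} isCompact_singleton
  exact HasCompactSupport.intro hL fun y hy => h x rfl y hy

theorem hasCompactSupport_kernelIntegral [T2Space X] [NormedSpace ℝ E] (hk : IsProperKernel k)
    (μ : Measure X) {ξ : X → E} (hξ' : HasCompactSupport ξ) :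
    HasCompactSupport (kernelIntegral μ k ξ) := by
  obtain ⟨L, hL, h⟩ := hk.right (tsupport ξ) hξ'
  refine HasCompactSupport.intro hL fun x hx => ?_
  have : ∀ y, k x y * ξ y = 0 := fun y => by
    by_cases hy : y ∈ tsupport ξ
    · rw [h y hy x hx, zero_mul]
    · rw [image_eq_zero_of_notMem_tsupport hy, mul_zero]
  simp [kernelIntegral, this]

theorem continuous_kernelIntegral [NormedSpace ℝ E] (hk : IsProperKernel k)
    (μ : Measure X) [IsFiniteMeasureOnCompacts μ] {ξ : X → E} (hξ : Continuous ξ)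
    (hξ' : HasCompactSupport ξ) : Continuous (kernelIntegral μ k ξ) := by
  rw [← continuousOn_univ]
  refine continuousOn_integral_of_compact_support (k := tsupport ξ) hξ' ?_ ?_
  · exact (hk.continuous.mul (hξ.comp continuous_snd)).continuousOn
  · intro p x _ hx
    rw [image_eq_zero_of_notMem_tsupport hx, mul_zero]

theorem hasCompactSupport_uncurry_mul [T2Space X] (hk : IsProperKernel k) {ξ : X → E}
    (hξ' : HasCompactSupport ξ) :
    HasCompactSupport (uncurry fun x y => k x y * ξ y) := by
  obtain ⟨L, hL, h⟩ := hk.right (tsupport ξ) hξ'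
  refine HasCompactSupport.intro (hL.prod hξ') fun p hp => ?_
  rcases p with ⟨x, y⟩
  simp only [mem_prod, not_and_or] at hp
  simp only [uncurry]
  by_cases hy : y ∈ tsupport ξ
  · rw [h y hy x (by tauto), zero_mul]
  · rw [image_eq_zero_of_notMem_tsupport hy, mul_zero]

end

variable [T2Space X] {μ : Measure X} {k : X → X → ℂ}

theorem memLp_section [IsFiniteMeasureOnCompacts μ] (hk : IsProperKernel k) (x : X) :
    MemLp (k x) 2 μ :=
  (hk.continuous_section x).memLp_of_hasCompactSupport (hk.hasCompactSupport_section x)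

theorem integrable_mul [IsFiniteMeasureOnCompacts μ] (hk : IsProperKernel k) (x : X)
    {ξ : X → ℂ} (hξ : MemLp ξ 2 μ) : Integrable (fun y => k x y * ξ y) μ :=
  (hk.memLp_section x).integrable_mul hξ

/-- `K ξ` depends continuously on `ξ ∈ L²`, pointwise. -/
theorem norm_kernelIntegral_sub_le [IsFiniteMeasureOnCompacts μ] (hk : IsProperKernel k) (x : X)
    {ξ ζ : X → ℂ} (hξ : MemLp ξ 2 μ) (hζ : MemLp ζ 2 μ) :
    ‖kernelIntegral μ k ξ x - kernelIntegral μ k ζ x‖ ≤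
      (eLpNorm (k x) 2 μ * eLpNorm (ξ - ζ) 2 μ).toReal := by
  have e : kernelIntegral μ k ξ x - kernelIntegral μ k ζ x =
      ∫ y, k x y * (ξ - ζ) y ∂μ := by
    rw [kernelIntegral, kernelIntegral, ← integral_sub (hk.integrable_mul x hξ)
      (hk.integrable_mul x hζ)]
    simp [mul_sub]
  rw [e]
  have hi := hk.integrable_mul x (hξ.sub hζ)
  have h1 : eLpNorm (fun y => k x y * (ξ - ζ) y) 1 μ ≤
      eLpNorm (k x) 2 μ * eLpNorm (ξ - ζ) 2 μ := by
    have := eLpNorm_smul_le_mul_eLpNorm (p := 2) (q := 2) (r := 1) (μ := μ)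
      (hξ.sub hζ).aestronglyMeasurable (hk.memLp_section x).aestronglyMeasurable
    exact this
  calc ‖∫ y, k x y * (ξ - ζ) y ∂μ‖ ≤ ∫ y, ‖k x y * (ξ - ζ) y‖ ∂μ := norm_integral_le_integral_norm _
    _ = (eLpNorm (fun y => k x y * (ξ - ζ) y) 1 μ).toReal := by
        rw [integral_norm_eq_lintegral_enorm hi.aestronglyMeasurable, eLpNorm_one_eq_lintegral_enorm]
    _ ≤ _ := ENNReal.toReal_mono
        (ENNReal.mul_ne_top (hk.memLp_section x).eLpNorm_ne_top (hξ.sub hζ).eLpNorm_ne_top) h1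

end IsProperKernel

/-- In a locally compact Hausdorff space, square integrable functions are approximated by
continuous compactly supported functions. -/
theorem exists_hasCompactSupport_eLpNorm_sub_le [T2Space X] [LocallyCompactSpace X]
    {μ : Measure X} [μ.Regular] {ξ : X → ℂ} (hξ : MemLp ξ 2 μ) {ε : ℝ≥0∞} (hε : ε ≠ 0) :
    ∃ g : X → ℂ, HasCompactSupport g ∧ eLpNorm (ξ - g) 2 μ ≤ ε ∧ Continuous g ∧ MemLp g 2 μ := by
  suffices H : ∃ g : X → ℂ, eLpNorm (ξ - g) 2 μ ≤ ε ∧ Continuous g ∧ HasCompactSupport g by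
    obtain ⟨g, h1, h2, h3⟩ := H
    exact ⟨g, h3, h1, h2, h2.memLp_of_hasCompactSupport h3⟩
  have hp : (2 : ℝ≥0∞) ≠ ∞ := by norm_num
  apply hξ.induction_dense hp _ _ _ _ hε
  rotate_left
  · rintro f g ⟨hf, hf'⟩ ⟨hg, hg'⟩
    exact ⟨hf.add hg, hf'.add hg'⟩
  · rintro f ⟨hf, hf'⟩
    exact (hf.memLp_of_hasCompactSupport (p := 2) hf').aestronglyMeasurable
  intro c t ht htμ ε hε
  obtain ⟨δ, δpos, hδ⟩ := exists_Lp_half ℂ μ 2 hε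
  obtain ⟨η, ηpos, hη⟩ : ∃ η : NNReal, 0 < η ∧ ∀ s : Set X, μ s ≤ η →
      eLpNorm (s.indicator fun _x => c) 2 μ ≤ δ :=
    exists_eLpNorm_indicator_le (by norm_num) c δpos.ne'
  have hη' : (η : ℝ≥0∞) ≠ 0 := by exact_mod_cast ηpos.ne'
  -- The space need not be normal, so Urysohn's lemma is applied to a compact set s inside t. The
  -- symmetric difference costs one δ for t \ s and one for V \ s.
  obtain ⟨s, st, sc, scl, μs⟩ := ht.exists_isCompact_isClosed_sdiff_lt htμ.ne hη'
  obtain ⟨V, sV, Vo, hV', hV⟩ := scl.measurableSet.exists_isOpen_sdiff_lt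
    ((measure_mono st).trans_lt htμ).ne hη'
  obtain ⟨g, g1, g0, gc, gI⟩ := exists_continuous_one_zero_of_isCompact sc Vo.isClosed_compl
    (disjoint_compl_right_iff_subset.2 sV)
  have hgc : Continuous fun x => g x • c := by fun_prop
  have hgs : HasCompactSupport fun x => g x • c := gc.smul_right
  refine ⟨fun x => g x • c, ?_, hgc, hgs⟩
  have I1 : eLpNorm ((s.indicator fun _ => c) - t.indicator fun _ => c) 2 μ ≤ δ := by
    rw [← eLpNorm_neg, neg_sub, ← indicator_sdiff st]
    exact hη _ μs.le
  have I2 : eLpNorm ((fun x => g x • c) - s.indicator fun _ => c) 2 μ ≤ δ := by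
    refine (eLpNorm_mono fun x => ?_).trans (hη (V \ s) hV.le)
    by_cases hs : x ∈ s
    · simp [hs, g1 hs]
    · by_cases hv : x ∈ V
      · have := gI x
        simp only [Pi.sub_apply, indicator_of_notMem hs, sub_zero, norm_smul, Real.norm_eq_abs,
          abs_of_nonneg this.1, indicator_of_mem (show x ∈ V \ s from ⟨hv, hs⟩)]
        exact mul_le_of_le_one_left (norm_nonneg _) this.2
      · simp [hs, hv, g0 (show x ∈ Vᶜ from hv)]
  have := (hδ _ _ ((hgc.memLp_of_hasCompactSupport (p := 2) hgs).aestronglyMeasurable.sub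
    (aestronglyMeasurable_const.indicator scl.measurableSet))
    ((aestronglyMeasurable_const.indicator scl.measurableSet).sub
      (aestronglyMeasurable_const.indicator ht)) I2 I1).le
  simpa only [sub_add_sub_cancel] using this

/-- Every square integrable function is a limit of continuous compactly supported functions. -/
theorem exists_seq_tendsto_eLpNorm [T2Space X] [LocallyCompactSpace X] {μ : Measure X} [μ.Regular]
    {ξ : X → ℂ} (hξ : MemLp ξ 2 μ) :
    ∃ φ : ℕ → X → ℂ, (∀ n, Continuous (φ n) ∧ HasCompactSupport (φ n) ∧ MemLp (φ n) 2 μ) ∧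
      Tendsto (fun n => eLpNorm (ξ - φ n) 2 μ) atTop (𝓝 0) := by
  have h : ∀ n : ℕ, ∃ g : X → ℂ, HasCompactSupport g ∧
      eLpNorm (ξ - g) 2 μ ≤ ((n : ℝ≥0∞) + 1)⁻¹ ∧ Continuous g ∧ MemLp g 2 μ := fun n =>
    exists_hasCompactSupport_eLpNorm_sub_le hξ (by simp)
  choose g h1 h2 h3 h4 using h
  refine ⟨g, fun n => ⟨h3 n, h1 n, h4 n⟩, ?_⟩
  refine tendsto_of_tendsto_of_tendsto_of_le_of_le tendsto_const_nhds ?_ (fun _ => bot_le) h2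
  have := (ENNReal.tendsto_inv_nat_nhds_zero).comp (tendsto_add_atTop_nat 1)
  refine this.congr fun n => ?_
  simp

theorem eLpNorm_two_eq {μ : Measure X} {u : X → ℂ} (hu : MemLp u 2 μ) :
    eLpNorm u 2 μ = ENNReal.ofReal (Real.sqrt (∫ x, ‖u x‖ ^ 2 ∂μ)) := by
  rw [hu.eLpNorm_eq_integral_rpow_norm (by norm_num) (by norm_num), Real.sqrt_eq_rpow]
  norm_num

theorem KernelBound.eLpNorm_le [T2Space X] {μ : Measure X} [IsFiniteMeasureOnCompacts μ]
    {k : X → X → ℂ} {C : ℝ} (hC : 0 ≤ C) (hk : IsProperKernel k) (hb : KernelBound μ k C)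
    {ξ : X → ℂ} (hξ : Continuous ξ) (hξ' : HasCompactSupport ξ) :
    eLpNorm (kernelIntegral μ k ξ) 2 μ ≤ ENNReal.ofReal C * eLpNorm ξ 2 μ := by
  rw [eLpNorm_two_eq (hξ.memLp_of_hasCompactSupport hξ'),
    eLpNorm_two_eq ((hk.continuous_kernelIntegral μ hξ hξ').memLp_of_hasCompactSupport
      (hk.hasCompactSupport_kernelIntegral μ hξ')), ← ENNReal.ofReal_mul hC]
  refine ENNReal.ofReal_le_ofReal ?_
  calc Real.sqrt (∫ x, ‖kernelIntegral μ k ξ x‖ ^ 2 ∂μ)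
      ≤ Real.sqrt (C ^ 2 * ∫ x, ‖ξ x‖ ^ 2 ∂μ) := Real.sqrt_le_sqrt (hb ξ hξ hξ')
    _ = C * Real.sqrt (∫ x, ‖ξ x‖ ^ 2 ∂μ) := by
        rw [Real.sqrt_mul (sq_nonneg C), Real.sqrt_sq hC]

/-- The integral formula itself has to hold for every ξ in L², not just for an abstract extension by
density. Since each row of the kernel is in L², approximants of ξ give pointwise convergence of the
kernel integrals, and Fatou's lemma carries the bound to the limit. -/
theorem KernelBound.memLp_and_eLpNorm_le [T2Space X] [LocallyCompactSpace X] {μ : Measure X}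
    [μ.Regular] {k : X → X → ℂ} {C : ℝ} (hC : 0 ≤ C) (hk : IsProperKernel k)
    (hb : KernelBound μ k C) {ξ : X → ℂ} (hξ : MemLp ξ 2 μ) :
    MemLp (kernelIntegral μ k ξ) 2 μ ∧
      eLpNorm (kernelIntegral μ k ξ) 2 μ ≤ ENNReal.ofReal C * eLpNorm ξ 2 μ := by
  obtain ⟨φ, hφ, hlim⟩ := exists_seq_tendsto_eLpNorm hξ
  have hpt : ∀ x, Tendsto (fun n => kernelIntegral μ k (φ n) x) atTop
      (𝓝 (kernelIntegral μ k ξ x)) := by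
    intro x
    rw [tendsto_iff_norm_sub_tendsto_zero]
    have h0 : Tendsto (fun n => (eLpNorm (k x) 2 μ * eLpNorm (ξ - φ n) 2 μ).toReal) atTop
        (𝓝 0) := by
      have := ENNReal.Tendsto.const_mul hlim (Or.inr (hk.memLp_section (μ := μ) x).eLpNorm_ne_top)
      rw [mul_zero] at this
      exact (ENNReal.tendsto_toReal ENNReal.zero_ne_top).comp this
    refine squeeze_zero (fun _ => norm_nonneg _) (fun n => ?_) h0
    rw [norm_sub_rev]
    exact hk.norm_kernelIntegral_sub_le x hξ (hφ n).2.2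
  have hmeas : ∀ n, AEStronglyMeasurable (kernelIntegral μ k (φ n)) μ := fun n =>
    ((hk.continuous_kernelIntegral μ (hφ n).1 (hφ n).2.1).memLp_of_hasCompactSupport (p := 2)
      (hk.hasCompactSupport_kernelIntegral μ (hφ n).2.1)).aestronglyMeasurable
  have hle : eLpNorm (kernelIntegral μ k ξ) 2 μ ≤ ENNReal.ofReal C * eLpNorm ξ 2 μ := by
    -- Fatou's lemma; the bounds for `φ n` converge to the bound for ξ.
    refine (Lp.eLpNorm_lim_le_liminf_eLpNorm hmeas _ (Eventually.of_forall hpt)).trans ?_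
    have h1 : ∀ n, eLpNorm (kernelIntegral μ k (φ n)) 2 μ ≤
        ENNReal.ofReal C * (eLpNorm ξ 2 μ + eLpNorm (ξ - φ n) 2 μ) := fun n => by
      refine (hb.eLpNorm_le hC hk (hφ n).1 (hφ n).2.1).trans ?_
      gcongr
      have := eLpNorm_sub_le (p := 2) (μ := μ) hξ.aestronglyMeasurable
        (hξ.sub (hφ n).2.2).aestronglyMeasurable (by norm_num)
      simpa using this
    have h2 : Tendsto (fun n => ENNReal.ofReal C * (eLpNorm ξ 2 μ + eLpNorm (ξ - φ n) 2 μ))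
        atTop (𝓝 (ENNReal.ofReal C * eLpNorm ξ 2 μ)) := by
      have := ENNReal.Tendsto.const_mul (a := ENNReal.ofReal C)
        (tendsto_const_nhds (x := eLpNorm ξ 2 μ) |>.add hlim) (Or.inr ENNReal.ofReal_ne_top)
      simpa using this
    rw [← h2.liminf_eq]
    exact liminf_le_liminf (Eventually.of_forall h1)
  refine ⟨⟨aestronglyMeasurable_of_tendsto_ae atTop hmeas (Eventually.of_forall hpt), ?_⟩, hle⟩
  exact hle.trans_lt (ENNReal.mul_lt_top ENNReal.ofReal_lt_top hξ.eLpNorm_lt_top)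

/-- A bound on continuous compactly supported functions yields the bounded integral operator. -/
theorem KernelBound.exists_operator [T2Space X] [LocallyCompactSpace X] {μ : Measure X}
    [μ.Regular] {k : X → X → ℂ} {C : ℝ} (hC : 0 ≤ C) (hk : IsProperKernel k)
    (hb : KernelBound μ k C) :
    ∃ T : Lp ℂ 2 μ →L[ℂ] Lp ℂ 2 μ, IsKernelOperator μ k T ∧ ‖T‖ ≤ C := by
  have hm : ∀ ξ : Lp ℂ 2 μ, MemLp (kernelIntegral μ k ξ) 2 μ := fun ξ =>
    (hb.memLp_and_eLpNorm_le hC hk (Lp.memLp ξ)).1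
  let T₀ : Lp ℂ 2 μ →ₗ[ℂ] Lp ℂ 2 μ :=
    { toFun := fun ξ => (hm ξ).toLp
      map_add' := fun ξ ζ => by
        rw [← MemLp.toLp_add]
        refine MemLp.toLp_congr _ _ (Eventually.of_forall fun x => ?_)
        simp only [kernelIntegral, Pi.add_apply]
        rw [← integral_add (hk.integrable_mul x (Lp.memLp ξ)) (hk.integrable_mul x (Lp.memLp ζ))]
        refine integral_congr_ae ?_
        filter_upwards [Lp.coeFn_add ξ ζ] with y hy
        rw [hy, Pi.add_apply, mul_add]
      map_smul' := fun c ξ => by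
        rw [RingHom.id_apply, ← MemLp.toLp_const_smul]
        refine MemLp.toLp_congr _ _ (Eventually.of_forall fun x => ?_)
        simp only [kernelIntegral, Pi.smul_apply]
        rw [← integral_smul]
        refine integral_congr_ae ?_
        filter_upwards [Lp.coeFn_smul c ξ] with y hy
        rw [hy, Pi.smul_apply, smul_eq_mul, smul_eq_mul]
        ring }
  refine ⟨T₀.mkContinuous C fun ξ => ?_, fun ξ => ⟨Eventually.of_forall fun x =>
    hk.integrable_mul x (Lp.memLp ξ), (hm ξ).coeFn_toLp⟩, T₀.mkContinuous_norm_le hC _⟩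
  change ‖(hm ξ).toLp‖ ≤ C * ‖ξ‖
  rw [Lp.norm_toLp, Lp.norm_def]
  refine (ENNReal.toReal_mono ?_ (hb.memLp_and_eLpNorm_le hC hk (Lp.memLp ξ)).2).trans_eq ?_
  · exact ENNReal.mul_ne_top ENNReal.ofReal_ne_top (Lp.eLpNorm_ne_top ξ)
  · rw [ENNReal.toReal_mul, ENNReal.toReal_ofReal hC]

theorem IsKernelOperator.apply_toLp {μ : Measure X} {k : X → X → ℂ}
    {T : Lp ℂ 2 μ →L[ℂ] Lp ℂ 2 μ} (hT : IsKernelOperator μ k T) {ξ : X → ℂ}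
    (hξ : MemLp ξ 2 μ) : T hξ.toLp =ᵐ[μ] kernelIntegral μ k ξ := by
  refine (hT hξ.toLp).2.trans (Eventually.of_forall fun x => ?_)
  refine integral_congr_ae ?_
  filter_upwards [hξ.coeFn_toLp] with y hy
  rw [hy]

/-- A bounded integral operator satisfies its norm bound on compactly supported functions. -/
theorem IsKernelOperator.kernelBound [T2Space X] {μ : Measure X} [IsFiniteMeasureOnCompacts μ]
    {k : X → X → ℂ} (hk : IsProperKernel k) {T : Lp ℂ 2 μ →L[ℂ] Lp ℂ 2 μ}
    (hT : IsKernelOperator μ k T) {C : ℝ} (hC : ‖T‖ ≤ C) : KernelBound μ k C := by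
  intro ξ hξ hξ'
  have hm : MemLp ξ 2 μ := hξ.memLp_of_hasCompactSupport hξ'
  have hm' : MemLp (kernelIntegral μ k ξ) 2 μ :=
    (hk.continuous_kernelIntegral μ hξ hξ').memLp_of_hasCompactSupport
      (hk.hasCompactSupport_kernelIntegral μ hξ')
  have h0 : 0 ≤ C := (norm_nonneg T).trans hC
  have h1 : ‖T hm.toLp‖ ≤ C * ‖hm.toLp‖ := T.le_of_opNorm_le hC _
  have h2 : T hm.toLp = hm'.toLp :=
    Lp.ext ((hT.apply_toLp hm).trans hm'.coeFn_toLp.symm)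
  rw [h2, Lp.norm_toLp, Lp.norm_toLp, eLpNorm_two_eq hm, eLpNorm_two_eq hm',
    ENNReal.toReal_ofReal (Real.sqrt_nonneg _), ENNReal.toReal_ofReal (Real.sqrt_nonneg _)] at h1
  have h3 := pow_le_pow_left₀ (Real.sqrt_nonneg _) h1 2
  rwa [mul_pow, Real.sq_sqrt (integral_nonneg fun _ => sq_nonneg _),
    Real.sq_sqrt (integral_nonneg fun _ => sq_nonneg _)] at h3

theorem IsKernelOperator.unique {μ : Measure X} {k : X → X → ℂ}
    {S T : Lp ℂ 2 μ →L[ℂ] Lp ℂ 2 μ} (hS : IsKernelOperator μ k S)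
    (hT : IsKernelOperator μ k T) : S = T :=
  ContinuousLinearMap.ext fun ξ => Lp.ext ((hS ξ).2.trans (hT ξ).2.symm)

/-- Bounded operators on `L²` that agree on compactly supported functions are equal. -/
theorem clm_ext_of_hasCompactSupport [T2Space X] [LocallyCompactSpace X] {μ : Measure X}
    [μ.Regular] {S T : Lp ℂ 2 μ →L[ℂ] Lp ℂ 2 μ}
    (h : ∀ (ξ : X → ℂ) (hξ : MemLp ξ 2 μ), Continuous ξ → HasCompactSupport ξ →
      S hξ.toLp = T hξ.toLp) : S = T := by
  refine ContinuousLinearMap.ext fun ξ => ?_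
  obtain ⟨φ, hφ, hlim⟩ := exists_seq_tendsto_eLpNorm (Lp.memLp ξ)
  have hl : Tendsto (fun n => ((hφ n).2.2.toLp : Lp ℂ 2 μ)) atTop (𝓝 ξ) := by
    rw [Lp.tendsto_Lp_iff_tendsto_eLpNorm']
    refine hlim.congr fun n => ?_
    rw [eLpNorm_sub_comm]
    refine eLpNorm_congr_ae ?_
    filter_upwards [(hφ n).2.2.coeFn_toLp] with y hy
    simp [hy]
  refine tendsto_nhds_unique ((S.continuous.tendsto ξ).comp hl) ?_
  refine ((T.continuous.tendsto ξ).comp hl).congr fun n => ?_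
  exact (h _ (hφ n).2.2 (hφ n).1 (hφ n).2.1).symm

end Analysis

end

/-! ### The quotient map G → H\G, modular characters and the pushforward of μ -/

section

open Function Set
open scoped ENNReal Pointwise

section Regularity

variable {X Y : Type*} [TopologicalSpace X] [TopologicalSpace Y] [MeasurableSpace X]
  [MeasurableSpace Y] [BorelSpace X] [BorelSpace Y]

/-- The image of a regular measure under a proper map is regular. -/
theorem regular_map_of_isProperMap [T2Space Y] {π : X → Y} (hπ : IsProperMap π) (μ : Measure X)
    [μ.Regular] : (μ.map π).Regular where
  lt_top_of_isCompact K hK := by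
    rw [Measure.map_apply hπ.continuous.measurable hK.measurableSet]
    exact (hπ.isCompact_preimage hK).measure_lt_top
  outerRegular := by
    intro A hA r hr
    rw [Measure.map_apply hπ.continuous.measurable hA] at hr
    obtain ⟨U, hAU, hU, hUr⟩ := (π ⁻¹' A).exists_isOpen_lt_of_lt r hr
    -- This is the largest set whose preimage lies in U; it is open because proper maps are closed.
    refine ⟨(π '' Uᶜ)ᶜ, ?_, (hπ.isClosedMap _ hU.isClosed_compl).isOpen_compl, ?_⟩
    · rintro a ha ⟨x, hx, rfl⟩
      exact hx (hAU ha)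
    · rw [Measure.map_apply hπ.continuous.measurable
        (hπ.isClosedMap _ hU.isClosed_compl).isOpen_compl.measurableSet]
      refine (measure_mono fun x hx => ?_).trans_lt hUr
      by_contra h
      exact hx ⟨x, h, rfl⟩
  innerRegular := by
    intro U hU r hr
    rw [Measure.map_apply hπ.continuous.measurable hU.measurableSet] at hr
    obtain ⟨K, hKU, hK, hKr⟩ := (hU.preimage hπ.continuous).exists_lt_isCompact hr
    refine ⟨π '' K, image_subset_iff.2 hKU, hK.image hπ.continuous, hKr.trans_le ?_⟩
    exact (measure_mono (subset_preimage_image π K)).trans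
      (Measure.le_map_apply hπ.continuous.aemeasurable _)

end Regularity

variable {G : Type*} [Group G] [TopologicalSpace G] [IsTopologicalGroup G] {H : Subgroup G}

section Topology

theorem mk_surjective : Surjective (CosetSpace.mk H) := Quotient.mk_surjective

theorem mk_eq_mk_iff {x y : G} : CosetSpace.mk H x = CosetSpace.mk H y ↔ y * x⁻¹ ∈ H :=
  Quotient.eq.trans QuotientGroup.rightRel_apply

theorem continuous_mk : Continuous (CosetSpace.mk H) := continuous_quotient_mk'

theorem mk_preimage_image (S : Set G) :
    CosetSpace.mk H ⁻¹' (CosetSpace.mk H '' S) = (H : Set G) * S := by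
  ext x
  simp only [mem_preimage, mem_image, mem_mul, mk_eq_mk_iff]
  constructor
  · rintro ⟨y, hy, h⟩
    exact ⟨_, h, y, hy, by group⟩
  · rintro ⟨h, hh, y, hy, rfl⟩
    exact ⟨y, hy, by simpa using hh⟩

theorem isOpenQuotientMap_mk : IsOpenQuotientMap (CosetSpace.mk H) where
  surjective := mk_surjective
  continuous := continuous_mk
  isOpenMap U hU := by
    have h : IsOpen (CosetSpace.mk H ⁻¹' (CosetSpace.mk H '' U)) := by
      rw [mk_preimage_image]
      exact hU.mul_left
    exact h

variable [T2Space G] [CompactSpace H]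

theorem isCompact_coe (H : Subgroup G) [CompactSpace H] : IsCompact (H : Set G) :=
  isCompact_iff_compactSpace.2 inferInstance

instance : T2Space (CosetSpace H) := by
  rw [t2Space_iff_of_isOpenQuotientMap isOpenQuotientMap_mk]
  simp only [mk_eq_mk_iff]
  exact (isCompact_coe H).isClosed.preimage (continuous_snd.mul continuous_fst.inv)

instance [LocallyCompactSpace G] : LocallyCompactSpace (CosetSpace H) :=
  isOpenQuotientMap_mk.locallyCompactSpace

/-- The saturation HS of a closed set S is closed because H is compact, and the fibres Hx are
compact. Properness lets compact supports be lifted to G and makes the pushforward of μ regular. -/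
theorem isProperMap_mk : IsProperMap (CosetSpace.mk H) := by
  rw [isProperMap_iff_isClosedMap_and_compact_fibers]
  refine ⟨continuous_mk, fun S hS => ?_, fun q => ?_⟩
  · rw [← isOpenQuotientMap_mk.isQuotientMap.isClosed_preimage, mk_preimage_image]
    exact hS.mul_left_of_isCompact (isCompact_coe H)
  · obtain ⟨x, rfl⟩ := mk_surjective q
    rw [← image_singleton, mk_preimage_image]
    exact (isCompact_coe H).mul isCompact_singleton

theorem hasCompactSupport_comp_mk {E : Type*} [Zero E] {φ : CosetSpace H → E}
    (h : HasCompactSupport φ) : HasCompactSupport fun x => φ (CosetSpace.mk H x) := by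
  refine HasCompactSupport.intro (isProperMap_mk.isCompact_preimage h) fun x hx => ?_
  exact image_eq_zero_of_notMem_tsupport (f := φ) hx

end Topology

section Modular

variable [LocallyCompactSpace G] [MeasurableSpace G] [BorelSpace G]

theorem map_mul_right_eq_modularCharacter_smul (ρ : Measure G) [ρ.IsHaarMeasure] [ρ.Regular]
    (h : G) : ρ.map (· * h) = Measure.modularCharacter h • ρ := by
  have : (ρ.map (· * h)).Regular := Measure.Regular.map (Homeomorph.mulRight h)
  have := Measure.isMulLeftInvariant_eq_smul_of_regular (ρ.map (· * h)) ρ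
  rwa [← Measure.modularCharacterFun_eq_haarScalarFactor] at this

end Modular

/-- The modular character is trivial on compact subgroups. -/
theorem modularCharacter_eq_one_of_compact [LocallyCompactSpace G] [T2Space G] [CompactSpace H]
    {h : G} (hh : h ∈ H) : Measure.modularCharacter h = 1 := by
  borelize G
  obtain ⟨K, hK, hK1⟩ := exists_compact_mem_nhds (1 : G)
  let ρ : Measure G := Measure.haar
  -- KH is compact, has nonempty interior and is unchanged by right translation by h. Its Haar
  -- measure is finite and positive, so the scaling factor of that translation must be 1.
  have hSc : IsCompact (K * (H : Set G)) := hK.mul (isCompact_coe H)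
  have hS0 : ρ (K * (H : Set G)) ≠ 0 := by
    have : (interior (K * (H : Set G))).Nonempty := ⟨1, mem_interior_iff_mem_nhds.2
      (Filter.mem_of_superset hK1 fun x hx => ⟨x, hx, 1, H.one_mem, by simp⟩)⟩
    exact ((isOpen_interior.measure_pos ρ this).trans_le (measure_mono interior_subset)).ne'
  have hpre : (fun x => x * h) ⁻¹' (K * (H : Set G)) = K * (H : Set G) := by
    ext x
    constructor
    · rintro ⟨k, hk, h', hh', e⟩
      refine ⟨k, hk, h' * h⁻¹, H.mul_mem hh' (H.inv_mem hh), ?_⟩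
      change k * h' = x * h at e
      change k * (h' * h⁻¹) = x
      rw [← mul_assoc, e, mul_inv_cancel_right]
    · rintro ⟨k, hk, h', hh', rfl⟩
      exact ⟨k, hk, h' * h, H.mul_mem hh' hh, by simp [mul_assoc]⟩
  have h1 : ρ.map (· * h) (K * (H : Set G)) = ρ (K * (H : Set G)) := by
    rw [Measure.map_apply (measurable_mul_const h) hSc.measurableSet, hpre]
  rw [map_mul_right_eq_modularCharacter_smul, Measure.smul_apply, ENNReal.smul_def,
    smul_eq_mul] at h1
  have h2 : ((Measure.modularCharacter h : NNReal) : ℝ≥0∞) * ρ (K * (H : Set G)) =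
      1 * ρ (K * (H : Set G)) := by
    rw [h1, one_mul]
  exact_mod_cast (ENNReal.mul_left_inj hS0 hSc.measure_lt_top.ne).1 h2

theorem continuous_mulRight (g : G) : Continuous (CosetSpace.mulRight (H := H) g) :=
  isOpenQuotientMap_mk.continuous_comp_iff.1
    (continuous_mk.comp (continuous_mul_const g) : Continuous fun x => CosetSpace.mk H (x * g))

variable [LocallyCompactSpace G] [T2Space G] [MeasurableSpace G] [BorelSpace G] [CompactSpace H]
  {μ : Measure G} [μ.Regular] {η : Measure H} [η.Regular] [η.IsMulRightInvariant]
  {ν : Measure (CosetSpace H)} [ν.Regular]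

/-- The image of `μ` in `H \ G` is `η(H) ν`. -/
theorem IsWeilMeasure.map_mk (hν : IsWeilMeasure μ η ν) :
    μ.map (CosetSpace.mk H) = (η univ).toNNReal • ν := by
  -- Both measures are regular, so comparing integrals of C_c functions suffices. The orbit integral
  -- of a lifted function is m times that function.
  have := regular_map_of_isProperMap (isProperMap_mk (H := H)) μ
  refine Measure.ext_of_integral_eq_on_compactlySupported fun f => ?_
  have h := hν.weil (fun x => (f (CosetSpace.mk H x) : ℂ))
    (Complex.continuous_ofReal.comp (f.continuous.comp continuous_mk))
    (hasCompactSupport_comp_mk (f.hasCompactSupport.comp_left Complex.ofReal_zero))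
  have h2 : ∀ q, orbitIntegral η (fun x => (f (CosetSpace.mk H x) : ℂ)) q
      = ((η.real univ * f q : ℝ) : ℂ) := by
    intro q
    obtain ⟨x, rfl⟩ := mk_surjective q
    change ∫ h : H, ((f (CosetSpace.mk H (h * x)) : ℝ) : ℂ) ∂η = _
    simp_rw [fun h : H => CosetSpace.mk_mul_left h.2 x]
    simp
  simp_rw [h2] at h
  rw [integral_complex_ofReal, integral_complex_ofReal, Complex.ofReal_inj,
    integral_const_mul] at h
  have hf : Continuous fun q => f q := f.continuous
  rw [integral_map continuous_mk.aemeasurable hf.aestronglyMeasurable, h,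
    integral_smul_nnreal_measure]
  rfl

/-- The working form of Weil's formula: it applies to every a.e. strongly measurable function on
H\G, continuous or not, and needs no integrability. -/
theorem IsWeilMeasure.integral_comp_mk (hν : IsWeilMeasure μ η ν) {E : Type*}
    [NormedAddCommGroup E] [NormedSpace ℝ E] {φ : CosetSpace H → E}
    (hφ : AEStronglyMeasurable φ ν) :
    ∫ x, φ (CosetSpace.mk H x) ∂μ = η.real univ • ∫ q, φ q ∂ν := by
  have : AEStronglyMeasurable φ (μ.map (CosetSpace.mk H)) := by
    rw [hν.map_mk]
    exact hφ.mono_ac Measure.smul_absolutelyContinuous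
  rw [← integral_map continuous_mk.aemeasurable this, hν.map_mk, integral_smul_nnreal_measure]
  rfl

section Modular

variable [μ.IsMulRightInvariant] [μ.IsOpenPosMeasure]

instance isHaarMeasure_inv : (μ.inv).IsHaarMeasure where
  open_pos U hU hU' := by
    rw [Measure.inv_apply]
    exact hU.inv.measure_ne_zero μ hU'.inv

/-- A right Haar measure is left invariant under compact subgroups. -/
theorem measurePreserving_mul_left {h : G} (hh : h ∈ H) :
    MeasurePreserving (fun x => h * x) μ μ := by
  refine ⟨measurable_const_mul h, ?_⟩
  -- Inversion turns μ into a left Haar measure and left translation by h into right translation by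
  -- h⁻¹, which scales by the modular character, here 1.
  have h1 := map_mul_right_eq_modularCharacter_smul μ.inv h⁻¹
  rw [modularCharacter_eq_one_of_compact (H.inv_mem hh), one_smul] at h1
  have h2 : (μ.inv.map (· * h⁻¹)).inv = μ := by rw [h1, Measure.inv_inv]
  have h3 : (μ.inv.map (· * h⁻¹)).inv = μ.map (fun x => h * x) := by
    simp only [Measure.inv]
    rw [Measure.map_map measurable_inv (measurable_mul_const _),
      Measure.map_map (by fun_prop) measurable_inv]
    congr 1
    ext x
    simp
  rw [← h3, h2]

end Modular

end

/-! ### Convolution kernels, Schur's test and transfer of bounds to H\G -/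

section

open Function Set
open scoped ENNReal Pointwise

section Kernels

variable {G : Type*} [Group G] [TopologicalSpace G] [IsTopologicalGroup G] {H : Subgroup G}

/-- The kernel `(x, y) ↦ F(x y⁻¹)` on `G × G`. -/
def groupKernel {E : Type*} (F : G → E) (x y : G) : E := F (x * y⁻¹)

theorem isProperKernel_groupKernel {E : Type*} [TopologicalSpace E] [Zero E] {F : G → E}
    (hF : Continuous F) (hF' : HasCompactSupport F) : IsProperKernel (groupKernel F) where
  continuous := hF.comp (continuous_fst.mul continuous_snd.inv)
  left K hK := by
    refine ⟨(tsupport F)⁻¹ * K, hF'.isCompact.inv.mul hK, fun x hx y hy => ?_⟩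
    by_contra h
    exact hy ⟨(x * y⁻¹)⁻¹, Set.inv_mem_inv.2 (subset_tsupport F h), x, hx, by simp⟩
  right K hK := by
    refine ⟨tsupport F * K, hF'.isCompact.mul hK, fun y hy x hx => ?_⟩
    by_contra h
    exact hx ⟨x * y⁻¹, subset_tsupport F h, y, hy, by simp⟩

theorem continuous_comp_mk (f : heckeAlgebra H) : Continuous fun x => f.1 (CosetSpace.mk H x) :=
  f.2.1.comp continuous_mk

/-- Translations cancel in x y⁻¹. Together with the invariance of ν this keeps products inside
ℋ(G,H) and makes λ multiplicative. -/
theorem convolutionKernel_mulRight (f : heckeAlgebra H) (g : G) (p q : CosetSpace H) :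
    convolutionKernel f (CosetSpace.mulRight g p) (CosetSpace.mulRight g q) =
      convolutionKernel f p q := by
  obtain ⟨x, rfl⟩ := mk_surjective p
  obtain ⟨y, rfl⟩ := mk_surjective q
  change f.1 (CosetSpace.mk H (x * g * (y * g)⁻¹)) = f.1 (CosetSpace.mk H (x * y⁻¹))
  rw [show x * g * (y * g)⁻¹ = x * y⁻¹ by group]

variable [T2Space G] [CompactSpace H]

/-- Everything is checked on G × G, where the kernel becomes `groupKernel` of the lift of f; the
compact sets found there are projected to H\G. -/
theorem isProperKernel_convolutionKernel (f : heckeAlgebra H) :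
    IsProperKernel (convolutionKernel f) where
  continuous := by
    refine (isOpenQuotientMap_mk.prodMap isOpenQuotientMap_mk).continuous_comp_iff.1 ?_
    exact (continuous_comp_mk f).comp (continuous_fst.mul continuous_snd.inv)
  left K hK := by
    obtain ⟨L, hL, h⟩ := (isProperKernel_groupKernel (continuous_comp_mk f)
      (hasCompactSupport_comp_mk f.2.2.1)).left _ (isProperMap_mk.isCompact_preimage hK)
    refine ⟨CosetSpace.mk H '' L, hL.image continuous_mk, fun p hp q hq => ?_⟩
    obtain ⟨x, rfl⟩ := mk_surjective p
    obtain ⟨y, rfl⟩ := mk_surjective q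
    exact h x hp y fun hy => hq ⟨y, hy, rfl⟩
  right K hK := by
    obtain ⟨L, hL, h⟩ := (isProperKernel_groupKernel (continuous_comp_mk f)
      (hasCompactSupport_comp_mk f.2.2.1)).right _ (isProperMap_mk.isCompact_preimage hK)
    refine ⟨CosetSpace.mk H '' L, hL.image continuous_mk, fun q hq p hp => ?_⟩
    obtain ⟨x, rfl⟩ := mk_surjective p
    obtain ⟨y, rfl⟩ := mk_surjective q
    exact h y hq x fun hx => hp ⟨x, hx, rfl⟩

end Kernels

variable {G : Type*} [Group G] [TopologicalSpace G] [IsTopologicalGroup G]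
  [LocallyCompactSpace G] [T2Space G] [MeasurableSpace G] [BorelSpace G]
  {μ : Measure G} [μ.Regular] [μ.IsMulRightInvariant]

theorem integral_groupKernel_right (F : G → ℝ) (x : G) :
    ∫ y, groupKernel F x y ∂μ = ∫ y, F y⁻¹ ∂μ := by
  rw [← integral_mul_right_eq_self (fun y => F y⁻¹) x⁻¹]
  simp [groupKernel]

/-- Schur's test: convolution by a continuous compactly supported function is bounded. -/
theorem exists_kernelBound_groupKernel {F : G → ℂ} (hF : Continuous F)
    (hF' : HasCompactSupport F) : ∃ C, 0 ≤ C ∧ KernelBound μ (groupKernel F) C := by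
  set N : G → ℝ := fun x => ‖F x‖ with hN
  have hNc : Continuous N := hF.norm
  have hNs : HasCompactSupport N := hF'.norm
  have hk := isProperKernel_groupKernel hNc hNs
  -- Row and column integrals of the kernel. They may differ, because μ is right invariant but not
  -- necessarily invariant under inversion.
  set A : ℝ := ∫ y, N y⁻¹ ∂μ
  set B : ℝ := ∫ x, N x ∂μ
  have hA : 0 ≤ A := integral_nonneg fun _ => norm_nonneg _
  have hB : 0 ≤ B := integral_nonneg fun _ => norm_nonneg _
  refine ⟨Real.sqrt (A * B), Real.sqrt_nonneg _, fun ξ hξ hξ' => ?_⟩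
  rw [Real.sq_sqrt (mul_nonneg hA hB)]
  set w : G → ℝ := fun y => ‖ξ y‖ ^ 2 with hw
  have hwc : Continuous w := hξ.norm.pow 2
  have hws : HasCompactSupport w := by
    simp only [hw, sq]
    exact hξ'.norm.mul_left
  have hpt : ∀ x, ‖kernelIntegral μ (groupKernel F) ξ x‖ ^ 2 ≤
      A * kernelIntegral μ (groupKernel N) w x := by
    intro x
    -- Split |F(xy⁻¹)| |ξ(y)| as u · (u |ξ|) with u² = |F(xy⁻¹)| and apply Cauchy–Schwarz; the first
    -- factor gives the row integral A.
    set u : G → ℝ := fun y => Real.sqrt (groupKernel N x y) with hu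
    have huc : Continuous u := (hk.continuous_section x).sqrt
    have hus : HasCompactSupport u := (hk.hasCompactSupport_section x).comp_left Real.sqrt_zero
    have hu2 : ∀ y, u y ^ 2 = groupKernel N x y := fun y => Real.sq_sqrt (norm_nonneg _)
    have h1 : ‖kernelIntegral μ (groupKernel F) ξ x‖ ≤ ∫ y, u y * (u y * ‖ξ y‖) ∂μ := by
      refine (norm_integral_le_integral_norm _).trans_eq ?_
      congr 1
      ext y
      rw [← mul_assoc, ← sq, hu2, norm_mul]
      rfl
    have h2 := sq_integral_mul_le_of_continuous (μ := μ) huc hus (huc.mul hξ.norm) hus.mul_right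
    refine (pow_le_pow_left₀ (norm_nonneg _) h1 2).trans (h2.trans_eq ?_)
    congr 1
    · exact (integral_congr_ae (.of_forall hu2)).trans (integral_groupKernel_right N x)
    · exact integral_congr_ae (.of_forall fun y => by simp only [Pi.mul_apply, mul_pow, hu2, hw])
  have hKc := hk.continuous_kernelIntegral μ hwc hws
  have hKs := hk.hasCompactSupport_kernelIntegral μ hws
  have hFk := isProperKernel_groupKernel hF hF'
  calc ∫ x, ‖kernelIntegral μ (groupKernel F) ξ x‖ ^ 2 ∂μ
      ≤ ∫ x, A * kernelIntegral μ (groupKernel N) w x ∂μ :=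
        integral_mono (integrable_norm_sq (hFk.continuous_kernelIntegral μ hξ hξ')
          (hFk.hasCompactSupport_kernelIntegral μ hξ'))
          ((hKc.integrable_of_hasCompactSupport hKs).const_mul A) hpt
    _ = A * ∫ x, ∫ y, groupKernel N x y * w y ∂μ ∂μ := integral_const_mul _ _
    _ = A * ∫ y, ∫ x, groupKernel N x y * w y ∂μ ∂μ := by
        rw [integral_integral_swap_of_hasCompactSupport
          (hk.continuous.mul (hwc.comp continuous_snd)) (hk.hasCompactSupport_uncurry_mul hws)]
    _ = A * ∫ y, B * w y ∂μ := by
        congr 2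
        ext y
        rw [integral_mul_const]
        congr 1
        exact integral_mul_right_eq_self N y⁻¹
    _ = A * B * ∫ x, ‖ξ x‖ ^ 2 ∂μ := by rw [integral_const_mul, mul_assoc]

section Transfer

variable {H : Subgroup G} [CompactSpace H] {η : Measure H} [η.Regular] [η.IsMulRightInvariant]
  {ν : Measure (CosetSpace H)} [ν.Regular]

theorem measureReal_univ_pos (η : Measure H) [IsFiniteMeasureOnCompacts η] [η.IsOpenPosMeasure] :
    0 < η.real univ :=
  ENNReal.toReal_pos (isOpen_univ.measure_ne_zero η univ_nonempty)
    (isCompact_univ.measure_lt_top).ne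

theorem IsWeilMeasure.kernelIntegral_comp_mk (hν : IsWeilMeasure μ η ν) (f : heckeAlgebra H)
    {ξ : CosetSpace H → ℂ} (hξ : Continuous ξ) (x : G) :
    kernelIntegral μ (groupKernel fun x => f.1 (CosetSpace.mk H x))
      (fun y => ξ (CosetSpace.mk H y)) x =
      η.real univ • kernelIntegral ν (convolutionKernel f) ξ (CosetSpace.mk H x) := by
  have hk := isProperKernel_convolutionKernel f
  exact hν.integral_comp_mk (φ := fun q => convolutionKernel f (CosetSpace.mk H x) q * ξ q)
    ((hk.continuous_section _).mul hξ).aestronglyMeasurable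

/-- Of the three factors of η(H), two come from squaring the one in the convolution and the third
from the outer integral. -/
theorem IsWeilMeasure.integral_norm_sq_kernelIntegral (hν : IsWeilMeasure μ η ν)
    (f : heckeAlgebra H) {ξ : CosetSpace H → ℂ} (hξ : Continuous ξ) (hξ' : HasCompactSupport ξ) :
    ∫ x, ‖kernelIntegral μ (groupKernel fun x => f.1 (CosetSpace.mk H x))
      (fun y => ξ (CosetSpace.mk H y)) x‖ ^ 2 ∂μ =
      η.real univ ^ 3 * ∫ q, ‖kernelIntegral ν (convolutionKernel f) ξ q‖ ^ 2 ∂ν := by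
  have hk := isProperKernel_convolutionKernel f
  simp_rw [hν.kernelIntegral_comp_mk f hξ, norm_smul, mul_pow]
  rw [integral_const_mul, hν.integral_comp_mk
    (φ := fun q => ‖kernelIntegral ν (convolutionKernel f) ξ q‖ ^ 2)
    ((hk.continuous_kernelIntegral ν hξ hξ').norm.pow 2).aestronglyMeasurable, smul_eq_mul,
    Real.norm_eq_abs, sq_abs]
  ring

/-- Test the bound on lifted functions: the left side gains η(H)³ and the right side η(H), so C² is
divided by η(H)². -/
theorem IsWeilMeasure.kernelBound_convolutionKernel [η.IsOpenPosMeasure]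
    (hν : IsWeilMeasure μ η ν) (f : heckeAlgebra H) {C : ℝ}
    (hb : KernelBound μ (groupKernel fun x => f.1 (CosetSpace.mk H x)) C) :
    KernelBound ν (convolutionKernel f) (C / η.real univ) := by
  intro ξ hξ hξ'
  have hm := measureReal_univ_pos η
  have h := hb _ (hξ.comp continuous_mk) (hasCompactSupport_comp_mk hξ')
  have h2 := hν.integral_comp_mk (φ := fun q => ‖ξ q‖ ^ 2) (hξ.norm.pow 2).aestronglyMeasurable
  have h3 := hν.integral_norm_sq_kernelIntegral f hξ hξ'
  simp only [Function.comp_def] at h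
  rw [h2, h3, smul_eq_mul] at h
  rw [div_pow, div_mul_eq_mul_div, le_div_iff₀ (by positivity)]
  refine le_of_mul_le_mul_left ?_ hm
  linarith

end Transfer

end

/-! ### The regular representation of the Hecke algebra -/

section

open Function Set
open scoped ENNReal Pointwise

variable {G : Type*} [Group G] [TopologicalSpace G] [IsTopologicalGroup G]
  [LocallyCompactSpace G] [T2Space G] [MeasurableSpace G] [BorelSpace G]
  {H : Subgroup G} [CompactSpace H]
  {μ : Measure G} [μ.Regular] [μ.IsMulRightInvariant]
  {η : Measure H} [η.Regular] [η.IsMulRightInvariant] [η.IsOpenPosMeasure]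
  {ν : Measure (CosetSpace H)} [ν.Regular]

/-- `λ(f)` is a bounded operator on `L²(H \ G)`. -/
theorem IsWeilMeasure.exists_isConvolutionOperator (hν : IsWeilMeasure μ η ν)
    (f : heckeAlgebra H) :
    ∃ T : Lp ℂ 2 ν →L[ℂ] Lp ℂ 2 ν, IsKernelOperator ν (convolutionKernel f) T := by
  obtain ⟨C, hC, hb⟩ := exists_kernelBound_groupKernel (μ := μ) (continuous_comp_mk f)
    (hasCompactSupport_comp_mk f.2.2.1)
  obtain ⟨T, hT, -⟩ := KernelBound.exists_operator (div_nonneg hC (measureReal_univ_pos η).le)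
    (isProperKernel_convolutionKernel f) (hν.kernelBound_convolutionKernel f hb)
  exact ⟨T, hT⟩

/-- The operators `λ(f)` as a linear map. -/
theorem IsWeilMeasure.exists_linearMap (hν : IsWeilMeasure μ η ν) :
    ∃ lam : heckeAlgebra H →ₗ[ℂ] (Lp ℂ 2 ν →L[ℂ] Lp ℂ 2 ν),
      ∀ f, IsKernelOperator ν (convolutionKernel f) (lam f) := by
  choose L hL using hν.exists_isConvolutionOperator
  have hadd : ∀ f g : heckeAlgebra H, ∀ p q,
      convolutionKernel (f + g) p q = convolutionKernel f p q + convolutionKernel g p q := by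
    rintro f g ⟨x⟩ ⟨y⟩
    rfl
  have hsmul : ∀ (c : ℂ) (f : heckeAlgebra H), ∀ p q,
      convolutionKernel (c • f) p q = c * convolutionKernel f p q := by
    rintro c f ⟨x⟩ ⟨y⟩
    rfl
  refine ⟨{ toFun := L, map_add' := fun f g => ?_, map_smul' := fun c f => ?_ }, hL⟩
  · refine (hL (f + g)).unique fun ξ => ?_
    have hf := (isProperKernel_convolutionKernel f).integrable_mul (μ := ν) (ξ := ξ)
    have hg := (isProperKernel_convolutionKernel g).integrable_mul (μ := ν) (ξ := ξ)
    simp only [hadd, add_mul]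
    refine ⟨.of_forall fun p => (hf p (Lp.memLp ξ)).add (hg p (Lp.memLp ξ)), ?_⟩
    filter_upwards [Lp.coeFn_add (L f ξ) (L g ξ), (hL f ξ).2, (hL g ξ).2] with p h1 h2 h3
    rw [_root_.add_apply, h1, Pi.add_apply, h2, h3,
      integral_add (hf p (Lp.memLp ξ)) (hg p (Lp.memLp ξ))]
  · refine (hL (c • f)).unique fun ξ => ?_
    have hf := (isProperKernel_convolutionKernel f).integrable_mul (μ := ν) (ξ := ξ)
    simp only [hsmul, mul_assoc]
    refine ⟨.of_forall fun p => (hf p (Lp.memLp ξ)).const_mul c, ?_⟩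
    filter_upwards [Lp.coeFn_smul c (L f ξ), (hL f ξ).2] with p h1 h2
    rw [RingHom.id_apply, _root_.smul_apply, h1, Pi.smul_apply, h2,
      integral_const_mul, smul_eq_mul]

/-- The convolution product on the Hecke algebra. -/
def IsWeilMeasure.heckeMul (hν : IsWeilMeasure μ η ν) (f g : heckeAlgebra H) :
    heckeAlgebra H :=
  ⟨kernelIntegral ν (convolutionKernel f) g.1,
    (isProperKernel_convolutionKernel f).continuous_kernelIntegral ν g.2.1 g.2.2.1,
    (isProperKernel_convolutionKernel f).hasCompactSupport_kernelIntegral ν g.2.2.1, by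
      intro x h hh
      have hc : Continuous fun q => convolutionKernel f (CosetSpace.mk H (x * h)) q * g.1 q :=
        ((isProperKernel_convolutionKernel f).continuous_section _).mul g.2.1
      have h1 : ∀ q, g.1 (CosetSpace.mulRight h q) = g.1 q := by
        intro q
        obtain ⟨y, rfl⟩ := mk_surjective q
        exact g.2.2.2 y h hh
      -- Substitute q ↦ qh, which preserves ν; g is unchanged and the kernel moves back from xh to
      -- x.
      have h2 := integral_map (μ := ν) (continuous_mulRight (H := H) h).aemeasurable
        hc.aestronglyMeasurable
      rw [hν.map_mulRight h] at h2
      refine h2.trans (integral_congr_ae (.of_forall fun q => ?_))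
      simp only [h1]
      congr 1
      exact convolutionKernel_mulRight f h (CosetSpace.mk H x) q⟩

/-- Translating the variable of integration by z⁻¹ turns the value of f ∗ g at xz⁻¹ into a
composition of kernels. -/
theorem IsWeilMeasure.convolutionKernel_heckeMul (hν : IsWeilMeasure μ η ν)
    (f g : heckeAlgebra H) (p r : CosetSpace H) :
    convolutionKernel (hν.heckeMul f g) p r =
      ∫ q, convolutionKernel f p q * convolutionKernel g q r ∂ν := by
  obtain ⟨x, rfl⟩ := mk_surjective p
  obtain ⟨z, rfl⟩ := mk_surjective r
  have hc : Continuous fun q => convolutionKernel f (CosetSpace.mk H (x * z⁻¹)) q * g.1 q :=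
    ((isProperKernel_convolutionKernel f).continuous_section _).mul g.2.1
  have h2 := integral_map (μ := ν) (continuous_mulRight (H := H) z⁻¹).aemeasurable
    hc.aestronglyMeasurable
  rw [hν.map_mulRight z⁻¹] at h2
  refine h2.trans (integral_congr_ae (.of_forall fun q => ?_))
  obtain ⟨y, rfl⟩ := mk_surjective q
  exact congrArg (· * g.1 (CosetSpace.mk H (y * z⁻¹)))
    (convolutionKernel_mulRight f z⁻¹ (CosetSpace.mk H x) (CosetSpace.mk H y))

/-- Multiplicativity of λ on C_c functions. For fixed p the double integrand has compact support in
both variables, so the order of integration may be exchanged. -/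
theorem IsWeilMeasure.kernelIntegral_heckeMul (hν : IsWeilMeasure μ η ν)
    (f g : heckeAlgebra H) {ξ : CosetSpace H → ℂ} (hξ : Continuous ξ)
    (hξ' : HasCompactSupport ξ) (p : CosetSpace H) :
    kernelIntegral ν (convolutionKernel (hν.heckeMul f g)) ξ p =
      kernelIntegral ν (convolutionKernel f) (kernelIntegral ν (convolutionKernel g) ξ) p := by
  have hf := isProperKernel_convolutionKernel f
  have hg := isProperKernel_convolutionKernel g
  unfold kernelIntegral
  simp_rw [hν.convolutionKernel_heckeMul, ← integral_const_mul, ← integral_mul_const]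
  have hc : Continuous (uncurry fun q r => convolutionKernel f p q *
      (convolutionKernel g q r * ξ r)) :=
    ((hf.continuous_section p).comp continuous_fst).mul
      (hg.continuous.mul (hξ.comp continuous_snd))
  have hs : HasCompactSupport (uncurry fun q r => convolutionKernel f p q *
      (convolutionKernel g q r * ξ r)) :=
    HasCompactSupport.mul_left (hg.hasCompactSupport_uncurry_mul hξ')
  rw [integral_integral_swap_of_hasCompactSupport hc hs]
  simp only [mul_assoc]

theorem IsWeilMeasure.regularRepresentationWellDefined (hν : IsWeilMeasure μ η ν) :
    RegularRepresentationWellDefined ν := by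
  obtain ⟨lam, hlam⟩ := hν.exists_linearMap
  refine ⟨lam, hlam, fun f g => ⟨hν.heckeMul f g, fun a => ⟨?_, rfl⟩, ?_⟩⟩
  · exact (isProperKernel_convolutionKernel f).integrable_mul a
      (g.2.1.memLp_of_hasCompactSupport g.2.2.1)
  · refine clm_ext_of_hasCompactSupport fun ξ hm hξ hξ' => ?_
    have hm' : MemLp (kernelIntegral ν (convolutionKernel g) ξ) 2 ν :=
      ((isProperKernel_convolutionKernel g).continuous_kernelIntegral ν hξ
        hξ').memLp_of_hasCompactSupport
        ((isProperKernel_convolutionKernel g).hasCompactSupport_kernelIntegral ν hξ')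
    have h1 : lam g hm.toLp = hm'.toLp :=
      Lp.ext (((hlam g).apply_toLp hm).trans hm'.coeFn_toLp.symm)
    rw [ContinuousLinearMap.comp_apply, h1]
    refine Lp.ext (((hlam _).apply_toLp hm).trans (Filter.EventuallyEq.trans ?_
      ((hlam f).apply_toLp hm').symm))
    exact .of_forall fun p => hν.kernelIntegral_heckeMul f g hξ hξ' p

end

/-! ### Quadratic means over H and their convolutions -/

section

open Function Set
open scoped ENNReal Pointwise

variable {G : Type*} [Group G] [TopologicalSpace G] [IsTopologicalGroup G]
  [MeasurableSpace G] [BorelSpace G] {H : Subgroup G}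

/-- The quadratic mean `(∫_H b(h x)² dη(h))^{1/2}`. -/
def leftMean (η : Measure H) (b : G → ℝ) (x : G) : ℝ := Real.sqrt (∫ h : H, b (h * x) ^ 2 ∂η)

/-- The quadratic mean `(∫_H b(x h⁻¹)² dη(h))^{1/2}`. -/
def rightMean (η : Measure H) (b : G → ℝ) (x : G) : ℝ :=
  Real.sqrt (∫ h : H, b (x * (h : G)⁻¹) ^ 2 ∂η)

section Mean

variable {η : Measure H} {b : G → ℝ}

theorem leftMean_nonneg (x : G) : 0 ≤ leftMean η b x := Real.sqrt_nonneg _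

theorem leftMean_sq (x : G) : leftMean η b x ^ 2 = ∫ h : H, b (h * x) ^ 2 ∂η :=
  Real.sq_sqrt (integral_nonneg fun _ => sq_nonneg _)

theorem rightMean_sq (x : G) : rightMean η b x ^ 2 = ∫ h : H, b (x * (h : G)⁻¹) ^ 2 ∂η :=
  Real.sq_sqrt (integral_nonneg fun _ => sq_nonneg _)

theorem leftMean_mul_left [η.IsMulRightInvariant] {k : G} (hk : k ∈ H) (x : G) :
    leftMean η b (k * x) = leftMean η b x := by
  have := integral_mul_right_eq_self (μ := η) (fun h : H => b (h * x) ^ 2) ⟨k, hk⟩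
  unfold leftMean
  rw [← this]
  simp [mul_assoc]

theorem rightMean_mul_right [η.IsMulRightInvariant] {k : G} (hk : k ∈ H) (x : G) :
    rightMean η b (x * k) = rightMean η b x := by
  have := integral_mul_right_eq_self (μ := η) (fun h : H => b (x * (h : G)⁻¹) ^ 2) ⟨k⁻¹, H.inv_mem hk⟩
  unfold rightMean
  rw [← this]
  simp [mul_assoc]

/-- Left averaging preserves right invariance, so the left mean of a right mean is bi-invariant. -/
theorem leftMean_mul_right {k : G} (hb : ∀ x, b (x * k) = b x) (x : G) :
    leftMean η b (x * k) = leftMean η b x := by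
  simp only [leftMean, ← mul_assoc, hb]

variable [CompactSpace H] [IsFiniteMeasureOnCompacts η]

theorem continuous_leftMean (hb : Continuous b) : Continuous (leftMean η b) := by
  refine Continuous.sqrt (continuousOn_univ.1 ?_)
  refine continuousOn_integral_of_compact_support isCompact_univ ?_
    (fun p x _ hx => absurd (mem_univ x) hx)
  exact ((hb.comp ((continuous_subtype_val.comp continuous_snd).mul continuous_fst)).pow
    2).continuousOn

theorem continuous_rightMean (hb : Continuous b) : Continuous (rightMean η b) := by
  refine Continuous.sqrt (continuousOn_univ.1 ?_)
  refine continuousOn_integral_of_compact_support isCompact_univ ?_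
    (fun p x _ hx => absurd (mem_univ x) hx)
  exact ((hb.comp (continuous_fst.mul (continuous_subtype_val.comp continuous_snd).inv)).pow
    2).continuousOn

variable [T2Space G]

theorem hasCompactSupport_leftMean (hb : HasCompactSupport b) :
    HasCompactSupport (leftMean η b) := by
  refine HasCompactSupport.intro ((isCompact_coe H).mul hb.isCompact) fun x hx => ?_
  have : ∀ h : H, b (h * x) = 0 := fun h => by
    by_contra hn
    exact hx ⟨(h : G)⁻¹, H.inv_mem h.2, h * x, subset_tsupport b hn, by simp⟩
  simp [leftMean, this]

theorem hasCompactSupport_rightMean (hb : HasCompactSupport b) :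
    HasCompactSupport (rightMean η b) := by
  refine HasCompactSupport.intro (hb.isCompact.mul (isCompact_coe H)) fun x hx => ?_
  have : ∀ h : H, b (x * (h : G)⁻¹) = 0 := fun h => by
    by_contra hn
    exact hx ⟨x * (h : G)⁻¹, subset_tsupport b hn, h, h.2, by simp⟩
  simp [rightMean, this]

end Mean

/-- Cauchy–Schwarz on `H`. -/
theorem integral_mul_le_sqrt_mul_sqrt [CompactSpace H] (η : Measure H)
    [IsFiniteMeasureOnCompacts η] {u v : H → ℝ} (hu : Continuous u) (hv : Continuous v) :
    ∫ h, u h * v h ∂η ≤ Real.sqrt (∫ h, u h ^ 2 ∂η) * Real.sqrt (∫ h, v h ^ 2 ∂η) := by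
  rw [← Real.sqrt_mul (integral_nonneg fun _ => sq_nonneg _)]
  exact (le_abs_self _).trans (Real.abs_le_sqrt (sq_integral_mul_le_of_continuous hu
    (.of_compactSpace _) hv (.of_compactSpace _)))

variable [LocallyCompactSpace G] [T2Space G] [CompactSpace H]
  {μ : Measure G} [μ.Regular] [μ.IsMulRightInvariant] [μ.IsOpenPosMeasure]
  {η : Measure H} [η.Regular] [η.IsMulRightInvariant]

theorem integral_mul_left_eq_of_mem (f : G → ℝ) {h : G} (hh : h ∈ H) :
    ∫ x, f (h * x) ∂μ = ∫ x, f x ∂μ :=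
  (measurePreserving_mul_left hh).integral_comp (measurableEmbedding_mulLeft h) f

section Weighted

variable {w : G → ℝ}

/-- Fubini's theorem on `G × H` with a locally bounded Borel weight on `G`. -/
theorem integral_integral_swap_weighted (hw : Measurable w) (hw0 : ∀ x, 0 ≤ w x)
    (hwb : ∀ K : Set G, IsCompact K → BddAbove (w '' K)) {Φ : G → H → ℝ}
    (hΦ : Continuous (uncurry Φ)) (hΦ' : HasCompactSupport (uncurry Φ)) :
    ∫ x, (∫ h, Φ x h ∂η) * w x ∂μ = ∫ h, ∫ x, Φ x h * w x ∂μ ∂η := by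
  -- The weight is only Borel, so it is absorbed into the measure. Local boundedness keeps ρ finite
  -- on compact sets, and Fubini is needed only for the continuous factor.
  set ρ := μ.withDensity fun x => ENNReal.ofReal (w x) with hρ
  have hwm : Measurable fun x => ENNReal.ofReal (w x) := hw.ennreal_ofReal
  have : IsFiniteMeasureOnCompacts ρ := by
    refine ⟨fun K hK => ?_⟩
    obtain ⟨M, hM⟩ := hwb K hK
    rw [withDensity_apply _ hK.measurableSet]
    calc ∫⁻ x in K, ENNReal.ofReal (w x) ∂μ ≤ ∫⁻ _ in K, ENNReal.ofReal M ∂μ :=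
          setLIntegral_mono measurable_const fun x hx =>
            ENNReal.ofReal_le_ofReal (hM ⟨x, hx, rfl⟩)
      _ < ∞ := by
          rw [setLIntegral_const]
          exact ENNReal.mul_lt_top ENNReal.ofReal_lt_top hK.measure_lt_top
  have hi : ∀ g : G → ℝ, ∫ x, g x ∂ρ = ∫ x, g x * w x ∂μ := by
    intro g
    rw [hρ, integral_withDensity_eq_integral_toReal_smul hwm (.of_forall fun _ =>
      ENNReal.ofReal_lt_top)]
    refine integral_congr_ae (.of_forall fun x => ?_)
    simp only [ENNReal.toReal_ofReal (hw0 x), smul_eq_mul, mul_comm]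
  simp_rw [← hi]
  exact integral_integral_swap_of_hasCompactSupport hΦ hΦ'

/-- After exchanging the integrals, left translation by each h in H preserves both μ and the weight,
so every h contributes the same integral. -/
theorem integral_leftMean_sq_mul (hw : Measurable w) (hw0 : ∀ x, 0 ≤ w x)
    (hwb : ∀ K : Set G, IsCompact K → BddAbove (w '' K))
    (hwH : ∀ h ∈ H, ∀ x, w (h * x) = w x) {b : G → ℝ} (hb : Continuous b)
    (hb' : HasCompactSupport b) :
    ∫ x, leftMean η b x ^ 2 * w x ∂μ = η.real univ * ∫ x, b x ^ 2 * w x ∂μ := by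
  simp_rw [leftMean_sq]
  rw [integral_integral_swap_weighted hw hw0 hwb (Φ := fun x (h : H) => b (h * x) ^ 2)]
  · have : ∀ h : H, ∫ x, b (h * x) ^ 2 * w x ∂μ = ∫ x, b x ^ 2 * w x ∂μ := fun h => by
      rw [← integral_mul_left_eq_of_mem (fun x => b x ^ 2 * w x) h.2]
      simp only [hwH h h.2]
    simp [this]
  · exact (hb.comp ((continuous_subtype_val.comp continuous_snd).mul continuous_fst)).pow 2
  · refine HasCompactSupport.intro (((isCompact_coe H).mul hb'.isCompact).prod
      (isCompact_univ (X := H))) fun p hp => ?_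
    have : b (p.2 * p.1) = 0 := by
      by_contra hn
      exact hp ⟨⟨(p.2 : G)⁻¹, H.inv_mem p.2.2, p.2 * p.1, subset_tsupport b hn, by simp⟩,
        mem_univ _⟩
    simp [uncurry, this]

theorem integral_rightMean_sq_mul (hw : Measurable w) (hw0 : ∀ x, 0 ≤ w x)
    (hwb : ∀ K : Set G, IsCompact K → BddAbove (w '' K))
    (hwH : ∀ h ∈ H, ∀ x, w (x * h) = w x) {b : G → ℝ} (hb : Continuous b)
    (hb' : HasCompactSupport b) :
    ∫ x, rightMean η b x ^ 2 * w x ∂μ = η.real univ * ∫ x, b x ^ 2 * w x ∂μ := by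
  simp_rw [rightMean_sq]
  rw [integral_integral_swap_weighted hw hw0 hwb (Φ := fun x (h : H) => b (x * (h : G)⁻¹) ^ 2)]
  · have : ∀ h : H, ∫ x, b (x * (h : G)⁻¹) ^ 2 * w x ∂μ = ∫ x, b x ^ 2 * w x ∂μ := fun h => by
      rw [← integral_mul_right_eq_self (fun x => b x ^ 2 * w x) (h : G)⁻¹]
      simp only [hwH _ (H.inv_mem h.2)]
    simp [this]
  · exact (hb.comp (continuous_fst.mul (continuous_subtype_val.comp continuous_snd).inv)).pow 2
  · refine HasCompactSupport.intro ((hb'.isCompact.mul (isCompact_coe H)).prod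
      (isCompact_univ (X := H))) fun p hp => ?_
    have : b (p.1 * (p.2 : G)⁻¹) = 0 := by
      by_contra hn
      exact hp ⟨⟨p.1 * (p.2 : G)⁻¹, subset_tsupport b hn, p.2, p.2.2, by simp⟩, mem_univ _⟩
    simp [uncurry, this]

theorem integral_leftMean_sq {b : G → ℝ} (hb : Continuous b) (hb' : HasCompactSupport b) :
    ∫ x, leftMean η b x ^ 2 ∂μ = η.real univ * ∫ x, b x ^ 2 ∂μ := by
  have := integral_leftMean_sq_mul (μ := μ) (η := η) (w := fun _ => 1) measurable_const
    (fun _ => zero_le_one) (fun K _ => ⟨1, by rintro _ ⟨x, -, rfl⟩; rfl⟩) (fun _ _ _ => rfl) hb hb'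
  simpa only [mul_one] using this

end Weighted

/-- `η(H) (b ∗ c) ≤ b♯ ∗ c♭` for the right mean `b♯` and the left mean `c♭`. -/
theorem kernelIntegral_le_rightMean_leftMean {b c : G → ℝ} (hb : Continuous b)
    (hb' : HasCompactSupport b) (hb0 : ∀ x, 0 ≤ b x) (hc : Continuous c)
    (hc' : HasCompactSupport c) (hc0 : ∀ x, 0 ≤ c x) (x : G) :
    η.real univ * kernelIntegral μ (groupKernel b) c x ≤
      kernelIntegral μ (groupKernel (rightMean η b)) (leftMean η c) x := by
  have hcont : Continuous (uncurry fun (h : H) (y : G) =>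
      groupKernel b x ((h : G) * y) * c (h * y)) := by
    have h1 : Continuous fun p : H × G => (p.1 : G) * p.2 :=
      (continuous_subtype_val.comp continuous_fst).mul continuous_snd
    exact (hb.comp (continuous_const.mul h1.inv)).mul (hc.comp h1)
  have hsupp : HasCompactSupport (uncurry fun (h : H) (y : G) =>
      groupKernel b x ((h : G) * y) * c (h * y)) := by
    refine HasCompactSupport.intro ((isCompact_univ (X := H)).prod
      ((isCompact_coe H).mul hc'.isCompact)) fun p hp => ?_
    have : c (p.1 * p.2) = 0 := by
      by_contra hn
      exact hp ⟨mem_univ _, (p.1 : G)⁻¹, H.inv_mem p.1.2, p.1 * p.2, subset_tsupport c hn, by simp⟩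
    simp [uncurry, this]
  -- Replacing y by hy does not change the convolution integral, for any h in H; average over h,
  -- then apply Cauchy–Schwarz on H for fixed y.
  have h1 : η.real univ * kernelIntegral μ (groupKernel b) c x =
      ∫ h : H, ∫ y, groupKernel b x ((h : G) * y) * c (h * y) ∂μ ∂η := by
    have : ∀ h : H, ∫ y, groupKernel b x ((h : G) * y) * c (h * y) ∂μ =
        kernelIntegral μ (groupKernel b) c x := fun h =>
      integral_mul_left_eq_of_mem (fun y => groupKernel b x y * c y) h.2
    simp [this]
  rw [h1, integral_integral_swap_of_hasCompactSupport hcont hsupp]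
  have hk := isProperKernel_groupKernel (continuous_rightMean (η := η) hb)
    (hasCompactSupport_rightMean hb')
  refine integral_mono_of_nonneg
    (.of_forall fun y => integral_nonneg fun h => mul_nonneg (hb0 _) (hc0 _)) ?_
    (.of_forall fun y => ?_)
  · exact ((hk.continuous_section x).mul
      (continuous_leftMean hc)).integrable_of_hasCompactSupport
      (hk.hasCompactSupport_section x).mul_right
  · have h2 := integral_mul_le_sqrt_mul_sqrt η (u := fun h => b (x * y⁻¹ * (h : G)⁻¹))
      (v := fun h => c (h * y)) (hb.comp (continuous_const.mul continuous_subtype_val.inv))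
      (hc.comp (continuous_subtype_val.mul continuous_const))
    refine le_of_eq_of_le ?_ h2
    simp only [groupKernel, mul_inv_rev, mul_assoc]

/-- Minkowski's inequality: the left mean of `b ∗ c` is at most `b♭ ∗ c`. -/
theorem leftMean_kernelIntegral_le {b c : G → ℝ} (hb : Continuous b)
    (hb' : HasCompactSupport b) (hb0 : ∀ x, 0 ≤ b x) (hc : Continuous c)
    (hc' : HasCompactSupport c) (hc0 : ∀ x, 0 ≤ c x) (x : G) :
    leftMean η (kernelIntegral μ (groupKernel b) c) x ≤
      kernelIntegral μ (groupKernel (leftMean η b)) c x := by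
  set u := kernelIntegral μ (groupKernel b) c with hu
  have huc : Continuous u :=
    (isProperKernel_groupKernel hb hb').continuous_kernelIntegral μ hc hc'
  have hu0 : ∀ x, 0 ≤ u x := fun x => integral_nonneg fun y => mul_nonneg (hb0 _) (hc0 _)
  have hk := isProperKernel_groupKernel (continuous_leftMean (η := η) hb)
    (hasCompactSupport_leftMean hb')
  have hhx : Continuous fun p : H × G => (p.1 : G) * x :=
    (continuous_subtype_val.comp continuous_fst).mul continuous_const
  have hcont : Continuous (uncurry fun (h : H) (y : G) =>
      u (h * x) * (groupKernel b ((h : G) * x) y * c y)) :=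
    (huc.comp hhx).mul ((hb.comp (hhx.mul continuous_snd.inv)).mul (hc.comp continuous_snd))
  have hsupp : HasCompactSupport (uncurry fun (h : H) (y : G) =>
      u (h * x) * (groupKernel b ((h : G) * x) y * c y)) := by
    refine HasCompactSupport.intro ((isCompact_univ (X := H)).prod hc'.isCompact) fun p hp => ?_
    have : c p.2 = 0 := by
      by_contra hn
      exact hp ⟨mem_univ _, subset_tsupport c hn⟩
    simp [uncurry, this]
  -- Minkowski by duality: one factor of u² is expanded as b ∗ c, and Cauchy–Schwarz over H bounds
  -- the result by the left mean of u times the desired right side. That mean is then cancelled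
  -- unless it is zero.
  have h1 : leftMean η u x ^ 2 =
      ∫ y, ∫ h : H, u (h * x) * (groupKernel b ((h : G) * x) y * c y) ∂η ∂μ := by
    rw [leftMean_sq, ← integral_integral_swap_of_hasCompactSupport hcont hsupp]
    simp_rw [integral_const_mul, sq]
    rfl
  have h2 : leftMean η u x ^ 2 ≤
      leftMean η u x * kernelIntegral μ (groupKernel (leftMean η b)) c x := by
    rw [h1, kernelIntegral, ← integral_const_mul]
    refine integral_mono_of_nonneg (.of_forall fun y => integral_nonneg fun h =>
      mul_nonneg (hu0 _) (mul_nonneg (hb0 _) (hc0 _))) ?_ (.of_forall fun y => ?_)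
    · exact (((hk.continuous_section x).mul hc).integrable_of_hasCompactSupport
        (hk.hasCompactSupport_section x).mul_right).const_mul _
    · have h3 := integral_mul_le_sqrt_mul_sqrt η (u := fun h => u (h * x))
        (v := fun h => b (h * (x * y⁻¹))) (huc.comp (continuous_subtype_val.mul continuous_const))
        (hb.comp (continuous_subtype_val.mul continuous_const))
      have h4 := mul_le_mul_of_nonneg_right h3 (hc0 y)
      rw [← integral_mul_const] at h4
      refine (le_of_eq_of_le ?_ h4).trans_eq (mul_assoc _ _ _)
      simp only [groupKernel, mul_assoc]
  have h5 : 0 ≤ kernelIntegral μ (groupKernel (leftMean η b)) c x :=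
    integral_nonneg fun y => mul_nonneg (leftMean_nonneg _) (hc0 _)
  rcases (leftMean_nonneg (η := η) (b := u) x).eq_or_lt with h | h
  · rw [← h]; exact h5
  · rw [sq] at h2
    exact le_of_mul_le_mul_left h2 h

/-- Averaging the two factors of a convolution of nonnegative functions over `H`. -/
theorem integral_kernelIntegral_sq_le [η.IsOpenPosMeasure] {b c : G → ℝ} (hb : Continuous b)
    (hb' : HasCompactSupport b) (hb0 : ∀ x, 0 ≤ b x) (hc : Continuous c)
    (hc' : HasCompactSupport c) (hc0 : ∀ x, 0 ≤ c x) :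
    η.real univ ^ 3 * ∫ x, kernelIntegral μ (groupKernel b) c x ^ 2 ∂μ ≤
      ∫ x, kernelIntegral μ (groupKernel (leftMean η (rightMean η b))) (leftMean η c) x ^ 2 ∂μ := by
  have hm := measureReal_univ_pos η
  have hrc := continuous_rightMean (η := η) hb
  have hrs := hasCompactSupport_rightMean (η := η) hb'
  have hr0 : ∀ x, 0 ≤ rightMean η b x := fun x => Real.sqrt_nonneg _
  have hcc := continuous_leftMean (η := η) hc
  have hcs := hasCompactSupport_leftMean (η := η) hc'
  have hsq : ∀ {u : G → ℝ}, Continuous u → HasCompactSupport u →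
      Integrable (fun x => u x ^ 2) μ := fun {u} hu hu' =>
    (hu.pow 2).integrable_of_hasCompactSupport (by simpa only [sq] using hu'.mul_left)
  have k1 := isProperKernel_groupKernel hb hb'
  have k2 := isProperKernel_groupKernel hrc hrs
  have k3 := isProperKernel_groupKernel (continuous_leftMean (η := η) hrc)
    (hasCompactSupport_leftMean hrs)
  set u := kernelIntegral μ (groupKernel (rightMean η b)) (leftMean η c) with hu
  have huc : Continuous u := k2.continuous_kernelIntegral μ hcc hcs
  have hus : HasCompactSupport u := k2.hasCompactSupport_kernelIntegral μ hcs
  have e1 : η.real univ ^ 2 * ∫ x, kernelIntegral μ (groupKernel b) c x ^ 2 ∂μ ≤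
      ∫ x, u x ^ 2 ∂μ := by
    rw [← integral_const_mul]
    refine integral_mono ((hsq (k1.continuous_kernelIntegral μ hc hc')
      (k1.hasCompactSupport_kernelIntegral μ hc')).const_mul _) (hsq huc hus) fun x => ?_
    simp only [← mul_pow]
    exact pow_le_pow_left₀ (mul_nonneg hm.le (integral_nonneg fun y => mul_nonneg (hb0 _) (hc0 _)))
      (kernelIntegral_le_rightMean_leftMean hb hb' hb0 hc hc' hc0 x) 2
  -- Passing from u to its left mean multiplies the squared norm by exactly η(H). The left mean of
  -- the second factor is not averaged again, as Minkowski puts the mean on the first factor only.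
  have e2 : η.real univ * ∫ x, u x ^ 2 ∂μ ≤ ∫ x, kernelIntegral μ
      (groupKernel (leftMean η (rightMean η b))) (leftMean η c) x ^ 2 ∂μ := by
    rw [← integral_leftMean_sq huc hus]
    refine integral_mono (hsq (continuous_leftMean huc) (hasCompactSupport_leftMean hus))
      (hsq (k3.continuous_kernelIntegral μ hcc hcs) (k3.hasCompactSupport_kernelIntegral μ hcs))
      fun x => ?_
    exact pow_le_pow_left₀ (leftMean_nonneg x)
      (leftMean_kernelIntegral_le hrc hrs hr0 hcc hcs leftMean_nonneg x) 2
  calc _ = η.real univ * (η.real univ ^ 2 *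
        ∫ x, kernelIntegral μ (groupKernel b) c x ^ 2 ∂μ) := by ring
    _ ≤ η.real univ * ∫ x, u x ^ 2 ∂μ := mul_le_mul_of_nonneg_left e1 hm.le
    _ ≤ _ := e2

end

/-! ### Elements of the Hecke algebra, the Hecke pair, and measurability on H\G -/

section

open Function Set
open scoped ENNReal Pointwise

variable {G : Type*} [Group G] [TopologicalSpace G] [IsTopologicalGroup G]
  [LocallyCompactSpace G] [T2Space G] {H : Subgroup G} [CompactSpace H]

/-- Left `H`-invariant continuous compactly supported functions descend to `H \ G`. -/
theorem exists_comp_mk_eq {E : Type*} [TopologicalSpace E] [Zero E] {φ : G → E}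
    (hφ : Continuous φ) (hφ' : HasCompactSupport φ) (hH : ∀ h ∈ H, ∀ x, φ (h * x) = φ x) :
    ∃ ψ : CosetSpace H → E, Continuous ψ ∧ HasCompactSupport ψ ∧
      ∀ x, ψ (CosetSpace.mk H x) = φ x := by
  let ψ : CosetSpace H → E := Quotient.lift φ fun x y hxy => by
    rw [← hH _ (QuotientGroup.rightRel_apply.mp hxy) x, inv_mul_cancel_right]
  have e : ∀ x, ψ (CosetSpace.mk H x) = φ x := fun _ => rfl
  refine ⟨ψ, isOpenQuotientMap_mk.continuous_comp_iff.1 hφ,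
    HasCompactSupport.intro (hφ'.isCompact.image continuous_mk) fun q hq => ?_, e⟩
  obtain ⟨x, rfl⟩ := mk_surjective q
  rw [e]
  exact image_eq_zero_of_notMem_tsupport fun hx => hq ⟨x, hx, rfl⟩

variable [MeasurableSpace G] [BorelSpace G]

/-- The bi-invariant quadratic mean as an element of the Hecke algebra. -/
theorem exists_heckeAlgebra_eq_mean (η : Measure H) [η.Regular] [η.IsMulRightInvariant]
    {b : G → ℝ} (hb : Continuous b) (hb' : HasCompactSupport b) :
    ∃ f : heckeAlgebra H, ∀ x, f.1 (CosetSpace.mk H x) = (leftMean η (rightMean η b) x : ℂ) := by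
  obtain ⟨ψ, h1, h2, h3⟩ := exists_comp_mk_eq (H := H)
    (continuous_leftMean (η := η) (continuous_rightMean (η := η) hb))
    (hasCompactSupport_leftMean (hasCompactSupport_rightMean hb'))
    (fun h hh x => leftMean_mul_left hh x)
  refine ⟨⟨fun q => (ψ q : ℂ), Complex.continuous_ofReal.comp h1,
    h2.comp_left Complex.ofReal_zero, fun x h hh => ?_⟩, fun x => congrArg Complex.ofReal (h3 x)⟩
  simp only [h3]
  rw [leftMean_mul_right fun x => rightMean_mul_right hh x]

/-- Average a compactly supported function equal to 1 on the compact double coset HxH: each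
quadratic mean contributes a factor √η(H), so the value at Hx is η(H). -/
theorem exists_heckeAlgebra_apply_ne_zero (η : Measure H) [η.Regular] [η.IsMulRightInvariant]
    [η.IsOpenPosMeasure] (a : CosetSpace H) : ∃ f : heckeAlgebra H, f.1 a ≠ 0 := by
  obtain ⟨x, rfl⟩ := mk_surjective a
  have hS : IsCompact ((H : Set G) * {x} * (H : Set G)) :=
    ((isCompact_coe H).mul isCompact_singleton).mul (isCompact_coe H)
  obtain ⟨g, g1, -, gc, -⟩ := exists_continuous_one_zero_of_isCompact hS isClosed_empty
    (disjoint_empty _)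
  obtain ⟨f, hf⟩ := exists_heckeAlgebra_eq_mean η g.continuous gc
  refine ⟨f, ?_⟩
  have hg : ∀ h k : H, g (h * x * (k : G)⁻¹) = 1 := fun h k =>
    g1 ⟨h * x, ⟨h, h.2, x, rfl, rfl⟩, _, H.inv_mem k.2, rfl⟩
  rw [hf, Complex.ofReal_ne_zero]
  have hm := measureReal_univ_pos η
  have : leftMean η (rightMean η g) x = Real.sqrt (η.real univ * η.real univ) := by
    simp [leftMean, rightMean_sq, hg]
  rw [this]
  positivity

/-- A compact open subgroup meets each of its conjugates in a subgroup of finite index. -/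
theorem relIndex_map_conj_ne_zero (hH : IsOpen (H : Set G)) (x : G) :
    (H.map (MulAut.conj x).toMonoidHom).relIndex H ≠ 0 := by
  have h1 : IsOpen ((H.map (MulAut.conj x).toMonoidHom : Subgroup G) : Set G) := by
    have : ((H.map (MulAut.conj x).toMonoidHom : Subgroup G) : Set G) =
        (fun y => x⁻¹ * y * x) ⁻¹' H := by
      ext y
      simp only [Subgroup.coe_map, mem_image, SetLike.mem_coe, mem_preimage]
      constructor
      · rintro ⟨h, hh, rfl⟩
        simpa [mul_assoc] using hh
      · intro hy
        exact ⟨_, hy, by simp [mul_assoc]⟩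
    rw [this]
    exact hH.preimage (by fun_prop)
  have h2 : IsOpen (((H.map (MulAut.conj x).toMonoidHom).subgroupOf H : Subgroup H) : Set H) :=
    h1.preimage continuous_subtype_val
  -- An open subgroup of the compact group H has finitely many cosets.
  have := Subgroup.quotient_finite_of_isOpen _ h2
  exact Subgroup.index_ne_zero_of_finite

theorem isOpen_of_discreteTopology (h : DiscreteTopology (CosetSpace H)) :
    IsOpen (H : Set G) := by
  have h1 : IsOpen (CosetSpace.mk H ⁻¹' {CosetSpace.mk H 1}) :=
    (isOpen_discrete _).preimage continuous_mk
  rw [← image_singleton, mk_preimage_image] at h1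
  simpa using h1

variable {μ : Measure G} [μ.Regular] [μ.IsMulRightInvariant]
  {η : Measure H} [η.Regular] [η.IsMulRightInvariant] [η.IsOpenPosMeasure]
  {ν : Measure (CosetSpace H)} [ν.Regular]

/-- A compact subgroup forms a Hecke pair. -/
theorem IsWeilMeasure.isHeckePair (hν : IsWeilMeasure μ η ν) : IsHeckePair H ν where
  isClosed := (isCompact_coe H).isClosed
  of_discrete h := relIndex_map_conj_ne_zero (isOpen_of_discreteTopology h)
  modular_eq_one _ h := by
    have : CompactSpace (⊤ : Subgroup H) := isCompact_iff_compactSpace.1 isCompact_univ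
    exact ⟨modularCharacter_eq_one_of_compact h.2,
      modularCharacter_eq_one_of_compact (Subgroup.mem_top h)⟩
  regularRepresentation _ := hν.regularRepresentationWellDefined
  nondegenerate _ := exists_heckeAlgebra_apply_ne_zero η

section Descent

/-- A Borel set of finite measure contains a `σ`-compact set of full measure. -/
theorem exists_iUnion_isCompact_sdiff_eq_zero {A : Set G} (hA : MeasurableSet A) (hA' : μ A ≠ ∞) :
    ∃ K : ℕ → Set G, (∀ n, K n ⊆ A ∧ IsCompact (K n)) ∧ μ (A \ ⋃ n, K n) = 0 := by
  have h : ∀ n : ℕ, ∃ K ⊆ A, IsCompact K ∧ μ (A \ K) < ((n : ℝ≥0∞) + 1)⁻¹ := fun n => by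
    obtain ⟨K, h1, h2, -, h3⟩ := hA.exists_isCompact_isClosed_sdiff_lt hA'
      (ε := ((n : ℝ≥0∞) + 1)⁻¹) (by simp)
    exact ⟨K, h1, h2, h3⟩
  choose K h1 h2 h3 using h
  refine ⟨K, fun n => ⟨h1 n, h2 n⟩, ?_⟩
  by_contra h0
  obtain ⟨n, hn⟩ := ENNReal.exists_inv_nat_lt h0
  refine absurd ((measure_mono (sdiff_subset_sdiff_right (subset_iUnion K n))).trans_lt (h3 n)) ?_
  rw [not_lt]
  refine le_trans (ENNReal.inv_le_inv.2 ?_) hn.le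
  exact le_self_add

/-- A subset of `H \ G` with Borel preimage in `G` is measurable up to null sets on compacts. -/
theorem IsWeilMeasure.nullMeasurableSet_restrict (hν : IsWeilMeasure μ η ν)
    {S K : Set (CosetSpace H)} (hS : MeasurableSet (CosetSpace.mk H ⁻¹' S)) (hK : IsCompact K) :
    NullMeasurableSet S (ν.restrict K) := by
  -- Only the preimage of S is known to be Borel. It is exhausted by compact sets up to a null set,
  -- and their images are compact, hence Borel in H\G. Doing this for S and for Sᶜ traps S between
  -- Borel sets on K.
  have hcov : ∀ S : Set (CosetSpace H), MeasurableSet (CosetSpace.mk H ⁻¹' S) →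
      ∃ C ⊆ K ∩ S, MeasurableSet C ∧ μ (CosetSpace.mk H ⁻¹' ((K ∩ S) \ C)) = 0 := by
    intro S hS
    have hfin : μ (CosetSpace.mk H ⁻¹' (K ∩ S)) ≠ ∞ :=
      ((measure_mono (preimage_mono inter_subset_left)).trans_lt
        (isProperMap_mk.isCompact_preimage hK).measure_lt_top).ne
    obtain ⟨L, hL, h0⟩ := exists_iUnion_isCompact_sdiff_eq_zero
      ((continuous_mk.measurable hK.measurableSet).inter hS) hfin
    refine ⟨⋃ n, CosetSpace.mk H '' L n, iUnion_subset fun n => image_subset_iff.2 (hL n).1,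
      MeasurableSet.iUnion fun n => ((hL n).2.image continuous_mk).measurableSet, ?_⟩
    refine measure_mono_null (fun x hx => ?_) h0
    refine ⟨hx.1, fun hx' => hx.2 ?_⟩
    obtain ⟨n, hn⟩ := mem_iUnion.1 hx'
    exact mem_iUnion.2 ⟨n, x, hn, rfl⟩
  obtain ⟨C, hCS, hC, hC0⟩ := hcov S hS
  obtain ⟨D, hDS, hD, hD0⟩ := hcov Sᶜ hS.compl
  have hnull : ν (K \ (C ∪ D)) = 0 := by
    have h1 : μ (CosetSpace.mk H ⁻¹' (K \ (C ∪ D))) = 0 := by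
      refine measure_mono_null (fun x hx => ?_) (measure_union_null hC0 hD0)
      by_cases h : CosetSpace.mk H x ∈ S
      · exact Or.inl ⟨⟨hx.1, h⟩, fun h' => hx.2 (Or.inl h')⟩
      · exact Or.inr ⟨⟨hx.1, h⟩, fun h' => hx.2 (Or.inr h')⟩
    have hm : MeasurableSet (K \ (C ∪ D)) := hK.measurableSet.diff (hC.union hD)
    rw [← Measure.map_apply continuous_mk.measurable hm, hν.map_mk, Measure.smul_apply,
      ENNReal.smul_def, smul_eq_mul, mul_eq_zero] at h1
    refine h1.resolve_left ?_
    rw [ENNReal.coe_toNNReal (isCompact_univ.measure_lt_top).ne]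
    exact isOpen_univ.measure_ne_zero η univ_nonempty
  refine hC.nullMeasurableSet.congr ?_
  refine (ae_restrict_iff' hK.measurableSet).2 ?_
  filter_upwards [measure_eq_zero_iff_ae_notMem.1 hnull] with q hq hqK
  refine propext ⟨fun h => (hCS h).2, fun h => ?_⟩
  by_contra h'
  exact hq ⟨hqK, fun h'' => h''.elim h' fun hd => (hDS hd).2 h⟩

/-- Length functions are assumed Borel on G, whereas the weighted norm of the pair integrates over
H\G. This supplies the measurability needed to apply Weil's formula to the weight. -/
theorem IsWeilMeasure.aestronglyMeasurable_of_comp_mk (hν : IsWeilMeasure μ η ν)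
    {φ : CosetSpace H → ℝ} (hφ : Measurable fun x => φ (CosetSpace.mk H x))
    (hφ' : HasCompactSupport φ) : AEStronglyMeasurable φ ν := by
  have h1 : AEMeasurable φ (ν.restrict (tsupport φ)) :=
    NullMeasurable.aemeasurable fun s hs => hν.nullMeasurableSet_restrict (hφ hs) hφ'
  have h2 := (aestronglyMeasurable_indicator_iff (f := φ)
    (isClosed_tsupport φ).measurableSet).2 h1.aestronglyMeasurable
  rwa [indicator_eq_self.2 (subset_tsupport φ)] at h2

/-- The weighted norm on `H \ G` in terms of an integral over `G`. -/
theorem IsWeilMeasure.weightedNorm_sq (hν : IsWeilMeasure μ η ν) (l : PairLengthFunction H)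
    (s : ℝ) (f : heckeAlgebra H) :
    η.real univ * weightedNorm ν l s f ^ 2 =
      ∫ x, ‖f.1 (CosetSpace.mk H x)‖ ^ 2 * (1 + l.toFun x) ^ (2 * s) ∂μ := by
  have hl : ∀ q, 0 ≤ l.onCosets q := fun q => by
    obtain ⟨x, rfl⟩ := mk_surjective q
    exact l.nonneg' x
  rw [weightedNorm, Real.sq_sqrt (integral_nonneg fun q => mul_nonneg (sq_nonneg _)
    (Real.rpow_nonneg (by linarith [hl q]) _)), ← smul_eq_mul]
  refine (hν.integral_comp_mk
    (φ := fun q => ‖f.1 q‖ ^ 2 * (1 + l.onCosets q) ^ (2 * s)) ?_).symm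
  refine hν.aestronglyMeasurable_of_comp_mk ?_ ?_
  · exact ((continuous_comp_mk f).norm.pow 2).measurable.mul
      ((l.measurable'.const_add 1).pow_const _)
  · simp only [sq, mul_assoc]
    exact f.2.2.1.norm.mul_right

end Descent

end

/-! ### Property (RD): from the pair to the group -/

section

open Function Set
open scoped ENNReal Pointwise

variable {G : Type*} [Group G] [TopologicalSpace G] [IsTopologicalGroup G]
  [MeasurableSpace G] [BorelSpace G] {H : Subgroup G}

theorem PairLengthFunction.mul_right_eq (l : PairLengthFunction H) {h : G} (hh : h ∈ H) (x : G) :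
    l.toFun (x * h) = l.toFun x := by
  rw [← l.inv', mul_inv_rev, l.mul_left_eq (H.inv_mem hh), l.inv']

theorem PairLengthFunction.LocallyBoundedOnCosets.locallyBounded {l : PairLengthFunction H}
    (hl : l.LocallyBoundedOnCosets) : l.toLengthFunction.LocallyBounded := by
  intro K hK
  obtain ⟨M, hM⟩ := hl _ (hK.image (continuous_mk (H := H)))
  refine ⟨M, ?_⟩
  rintro _ ⟨x, hx, rfl⟩
  exact hM ⟨CosetSpace.mk H x, ⟨x, hx, rfl⟩, rfl⟩

theorem LengthFunction.bddAbove_weight {l : LengthFunction G} (hl : l.LocallyBounded) {s : ℝ}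
    (hs : 0 < s) {K : Set G} (hK : IsCompact K) :
    BddAbove ((fun x => (1 + l.toFun x) ^ (2 * s)) '' K) := by
  obtain ⟨M, hM⟩ := hl K hK
  refine ⟨(1 + M) ^ (2 * s), ?_⟩
  rintro _ ⟨x, hx, rfl⟩
  have h1 := l.nonneg' x
  exact Real.rpow_le_rpow (by linarith) (by linarith [hM ⟨x, hx, rfl⟩]) (by linarith)

theorem LengthFunction.weight_nonneg (l : LengthFunction G) (s : ℝ) (x : G) :
    0 ≤ (1 + l.toFun x) ^ s :=
  Real.rpow_nonneg (by linarith [l.nonneg' x]) _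

variable [LocallyCompactSpace G] [T2Space G] [CompactSpace H]
  {μ : Measure G} [μ.Regular] [μ.IsMulRightInvariant]
  {η : Measure H} [η.Regular] [η.IsMulRightInvariant] [η.IsOpenPosMeasure]
  {ν : Measure (CosetSpace H)} [ν.Regular]

theorem ofReal_kernelIntegral (b c : G → ℝ) (x : G) :
    kernelIntegral μ (groupKernel fun x => (b x : ℂ)) (fun y => (c y : ℂ)) x =
      ((kernelIntegral μ (groupKernel b) c x : ℝ) : ℂ) := by
  simp only [kernelIntegral, groupKernel]
  rw [← integral_complex_ofReal]
  simp

variable [μ.IsOpenPosMeasure]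

/-- The weight is bi-invariant because l vanishes on H. The two means contribute η(H)² to the
squared norm on G, and descending to H\G removes one factor. -/
theorem IsWeilMeasure.weightedNorm_mean_sq (hν : IsWeilMeasure μ η ν) {l : PairLengthFunction H}
    (hl : l.LocallyBoundedOnCosets) {s : ℝ} (hs : 0 < s) {F : G → ℂ} (hF : Continuous F)
    (hF' : HasCompactSupport F) {f : heckeAlgebra H}
    (hf : ∀ x, f.1 (CosetSpace.mk H x) = (leftMean η (rightMean η fun x => ‖F x‖) x : ℂ)) :
    weightedNorm ν l s f =
      Real.sqrt (η.real univ) * groupWeightedNorm μ l.toLengthFunction s F := by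
  have hm := measureReal_univ_pos η
  set w : G → ℝ := fun x => (1 + l.toFun x) ^ (2 * s) with hw
  have hwm : Measurable w := (l.measurable'.const_add 1).pow_const _
  have hw0 : ∀ x, 0 ≤ w x := l.weight_nonneg _
  have hwb : ∀ K : Set G, IsCompact K → BddAbove (w '' K) := fun K hK =>
    LengthFunction.bddAbove_weight hl.locallyBounded hs hK
  have hb : Continuous fun x => ‖F x‖ := hF.norm
  have hb' : HasCompactSupport fun x => ‖F x‖ := hF'.norm
  have h1 := hν.weightedNorm_sq l s f
  simp_rw [hf, Complex.norm_real, Real.norm_eq_abs, sq_abs] at h1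
  have h2 := integral_leftMean_sq_mul (μ := μ) (η := η) hwm hw0 hwb
    (fun h hh x => by simp only [hw, l.mul_left_eq hh]) (continuous_rightMean (η := η) hb)
    (hasCompactSupport_rightMean hb')
  have h3 := integral_rightMean_sq_mul (μ := μ) (η := η) hwm hw0 hwb
    (fun h hh x => by simp only [hw, l.mul_right_eq hh]) hb hb'
  rw [h2, h3] at h1
  have h4 : weightedNorm ν l s f ^ 2 = η.real univ * ∫ x, ‖F x‖ ^ 2 * w x ∂μ :=
    mul_left_cancel₀ hm.ne' h1
  rw [groupWeightedNorm, ← Real.sqrt_mul hm.le, ← h4,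
    Real.sqrt_sq (show 0 ≤ weightedNorm ν l s f from Real.sqrt_nonneg _)]

/-- If `λ(f)` is bounded by `C` for the bi-invariant mean `f` of `|F|`, so is `λ(F)`. -/
theorem IsWeilMeasure.kernelBound_of_mean (hν : IsWeilMeasure μ η ν) {F : G → ℂ}
    (hF : Continuous F) (hF' : HasCompactSupport F) {f : heckeAlgebra H}
    (hf : ∀ x, f.1 (CosetSpace.mk H x) = (leftMean η (rightMean η fun x => ‖F x‖) x : ℂ)) {C : ℝ}
    (hb : KernelBound ν (convolutionKernel f) C) : KernelBound μ (groupKernel F) C := by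
  intro ξ hξ hξ'
  have hm := measureReal_univ_pos η
  set b : G → ℝ := fun x => ‖F x‖ with hbdef
  set c : G → ℝ := fun x => ‖ξ x‖ with hcdef
  have hbc : Continuous b := hF.norm
  have hbs : HasCompactSupport b := hF'.norm
  have hcc : Continuous c := hξ.norm
  have hcs : HasCompactSupport c := hξ'.norm
  -- The left mean of |ξ|, viewed on H\G, is the test function for the assumed bound; its squared
  -- norm for ν equals that of ξ for μ.
  obtain ⟨γ, hγ, hγ', hγe⟩ := exists_comp_mk_eq (H := H) (continuous_leftMean (η := η) hcc)
    (hasCompactSupport_leftMean hcs) (fun h hh x => leftMean_mul_left hh x)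
  have hγc : Continuous fun q => (γ q : ℂ) := Complex.continuous_ofReal.comp hγ
  have hγs : HasCompactSupport fun q => (γ q : ℂ) := hγ'.comp_left Complex.ofReal_zero
  have k1 := isProperKernel_groupKernel hF hF'
  have k2 := isProperKernel_groupKernel hbc hbs
  have e1 : ∫ x, ‖kernelIntegral μ (groupKernel F) ξ x‖ ^ 2 ∂μ ≤
      ∫ x, kernelIntegral μ (groupKernel b) c x ^ 2 ∂μ := by
    have hu := k2.continuous_kernelIntegral μ hcc hcs
    have hu' := k2.hasCompactSupport_kernelIntegral μ hcs
    refine integral_mono (integrable_norm_sq (k1.continuous_kernelIntegral μ hξ hξ')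
      (k1.hasCompactSupport_kernelIntegral μ hξ')) ((hu.pow 2).integrable_of_hasCompactSupport
        (by simpa only [sq] using hu'.mul_left)) fun x => ?_
    refine pow_le_pow_left₀ (norm_nonneg _) ((norm_integral_le_integral_norm _).trans_eq ?_) 2
    simp only [norm_mul]
    rfl
  have e2 := integral_kernelIntegral_sq_le (μ := μ) (η := η) hbc hbs (fun _ => norm_nonneg _)
    hcc hcs (fun _ => norm_nonneg _)
  have e3 := hν.integral_norm_sq_kernelIntegral f hγc hγs
  simp_rw [hf, hγe, ofReal_kernelIntegral, Complex.norm_real, Real.norm_eq_abs, sq_abs] at e3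
  have e4 := hb _ hγc hγs
  have e5 := hν.integral_comp_mk (φ := fun q => γ q ^ 2) (hγ.pow 2).aestronglyMeasurable
  simp_rw [hγe] at e5
  rw [integral_leftMean_sq hcc hcs, smul_eq_mul] at e5
  have e6 : ∫ x, c x ^ 2 ∂μ = ∫ q, γ q ^ 2 ∂ν := mul_left_cancel₀ hm.ne' e5
  simp_rw [Complex.norm_real, Real.norm_eq_abs, sq_abs] at e4
  rw [e3] at e2
  rw [← e6] at e4
  -- The factor η(H)³ lost by averaging is exactly the one gained by lifting from H\G, so the
  -- constant C is unchanged.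
  exact e1.trans ((le_of_mul_le_mul_left e2 (by positivity)).trans e4)

theorem IsWeilMeasure.groupHasRD_of_pairHasRD (hν : IsWeilMeasure μ η ν) (h : PairHasRD ν) :
    GroupHasRD μ := by
  obtain ⟨l, hl, s, c, hs, hc, hRD⟩ := h
  have hm := measureReal_univ_pos η
  refine ⟨l.toLengthFunction, hl.locallyBounded, s, c * Real.sqrt (η.real univ), hs,
    by positivity, fun F hF hF' => ?_⟩
  obtain ⟨f, hf⟩ := exists_heckeAlgebra_eq_mean η (b := fun x => ‖F x‖) hF.norm hF'.norm
  obtain ⟨T, hT, hTn⟩ := hRD f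
  have hb := hν.kernelBound_of_mean hF hF' hf
    (IsKernelOperator.kernelBound (isProperKernel_convolutionKernel f) hT hTn)
  rw [hν.weightedNorm_mean_sq hl hs hF hF' hf, ← mul_assoc] at hb
  -- By definition `IsGroupConvolutionOperator μ F` is `IsKernelOperator μ (groupKernel F)`.
  exact KernelBound.exists_operator
    (mul_nonneg (by positivity) (Real.sqrt_nonneg _)) (isProperKernel_groupKernel hF hF') hb

end

/-! ### Property (RD): from the group to the pair -/

section

open Function Set
open scoped ENNReal Pointwise

variable {G : Type*} [Group G] [TopologicalSpace G] [IsTopologicalGroup G]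
  [LocallyCompactSpace G] [T2Space G] {H : Subgroup G} [CompactSpace H]

variable (H) in
/-- A compact subgroup has a relatively compact symmetric open neighbourhood invariant under the subgroup. -/
theorem exists_isOpen_invariant : ∃ V K : Set G, IsOpen V ∧ (1 : G) ∈ V ∧ V ⊆ K ∧ IsCompact K ∧
    (∀ v ∈ V, v⁻¹ ∈ V) ∧ ∀ h ∈ H, ∀ v ∈ V, h * v ∈ V := by
  obtain ⟨K, hK, hK1⟩ := exists_compact_mem_nhds (1 : G)
  set U : Set G := interior K ∩ (interior K)⁻¹ with hU
  have hUo : IsOpen U := isOpen_interior.inter isOpen_interior.inv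
  have h1 : (1 : G) ∈ interior K := mem_interior_iff_mem_nhds.2 hK1
  refine ⟨H * U * H, H * K * H, hUo.mul_left.mul_right, ?_, ?_,
    ((isCompact_coe H).mul hK).mul (isCompact_coe H), ?_, ?_⟩
  · exact ⟨1, ⟨1, H.one_mem, 1, ⟨h1, by simpa using h1⟩, by simp⟩, 1, H.one_mem, by simp⟩
  · exact mul_subset_mul_right (mul_subset_mul_left (inter_subset_left.trans interior_subset))
  · rintro _ ⟨_, ⟨h, hh, u, hu, rfl⟩, k, hk, rfl⟩
    exact ⟨k⁻¹ * u⁻¹, ⟨k⁻¹, H.inv_mem hk, u⁻¹, ⟨hu.2, by simpa using hu.1⟩, rfl⟩, h⁻¹,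
      H.inv_mem hh, by simp [mul_assoc]⟩
  · rintro g hg _ ⟨_, ⟨h, hh, u, hu, rfl⟩, k, hk, rfl⟩
    exact ⟨g * h * u, ⟨g * h, H.mul_mem hg hh, u, hu, rfl⟩, k, hk, by simp [mul_assoc]⟩

variable [MeasurableSpace G] [BorelSpace G]

variable (H) in
/-- Up to a constant, a locally bounded length function is `H`-bi-invariant with integer values. -/
theorem LengthFunction.exists_biinvariant (l : LengthFunction G) (hl : l.LocallyBounded) :
    ∃ (p : G → ℕ) (M : ℕ), Measurable p ∧ (∀ x, p x⁻¹ = p x) ∧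
      (∀ h ∈ H, ∀ x, p (h * x) = p x) ∧ (∀ x y, p (x * y) ≤ p x + p y + M) ∧
      (∀ x, l.toFun x ≤ p x + M) ∧ ∀ x, (p x : ℝ) ≤ l.toFun x + 1 := by
  obtain ⟨V, K, hV, hV1, hVK, hK, hVinv, hHV⟩ := exists_isOpen_invariant H
  obtain ⟨M₀, hM₀⟩ := hl K hK
  obtain ⟨M, hM⟩ := exists_nat_ge M₀
  have hVM : ∀ v ∈ V, l.toFun v ≤ M := fun v hv => (hM₀ ⟨v, hVK hv, rfl⟩).trans hM
  -- Multiplying by the open set V makes these sets open although the balls of l are only Borel, so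
  -- p is measurable; the H-invariance of V passes to p.
  let W : ℕ → Set G := fun n => V * {x | l.toFun x < n} * V
  have hWo : ∀ n, IsOpen (W n) := fun n => hV.mul_left
  have hmono : ∀ {m n : ℕ}, m ≤ n → W m ⊆ W n := fun {m n} h =>
    mul_subset_mul_right (mul_subset_mul_left fun x hx =>
      lt_of_lt_of_le (mem_ofPred_eq ▸ hx) (Nat.cast_le.2 h))
  have hlW : ∀ {x : G} {n : ℕ}, l.toFun x < n → x ∈ W n := fun {x n} h =>
    ⟨x, ⟨1, hV1, x, h, by simp⟩, 1, hV1, by simp⟩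
  have hne : ∀ x, {n : ℕ | x ∈ W n}.Nonempty := fun x => by
    obtain ⟨n, hn⟩ := exists_nat_gt (l.toFun x)
    exact ⟨n, hlW hn⟩
  let p : G → ℕ := fun x => sInf {n : ℕ | x ∈ W n}
  have hp : ∀ x, x ∈ W (p x) := fun x => Nat.sInf_mem (hne x)
  have hple : ∀ {x n}, x ∈ W n → p x ≤ n := fun h => Nat.sInf_le h
  have hinv : ∀ {x n}, x ∈ W n → x⁻¹ ∈ W n := by
    rintro _ n ⟨_, ⟨v, hv, b, hb, rfl⟩, u, hu, rfl⟩
    refine ⟨u⁻¹ * b⁻¹, ⟨u⁻¹, hVinv u hu, b⁻¹, ?_, rfl⟩, v⁻¹, hVinv v hv, by simp [mul_assoc]⟩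
    exact (l.inv' b).trans_lt hb
  have hH : ∀ {h x n}, h ∈ H → x ∈ W n → h * x ∈ W n := by
    rintro h _ n hh ⟨_, ⟨v, hv, b, hb, rfl⟩, u, hu, rfl⟩
    exact ⟨h * v * b, ⟨h * v, hHV h hh v hv, b, hb, rfl⟩, u, hu, by simp [mul_assoc]⟩
  refine ⟨p, 2 * M, ?_, fun x => ?_, fun h hh x => ?_, fun x y => ?_, fun x => ?_, fun x => ?_⟩
  · refine measurable_of_Iic fun n => ?_
    have : p ⁻¹' Iic n = W n := by
      ext x
      exact ⟨fun h => hmono h (hp x), fun h => hple h⟩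
    rw [this]
    exact (hWo n).measurableSet
  · exact le_antisymm (hple (hinv (hp x))) (hple (by simpa using hinv (hp x⁻¹)))
  · exact le_antisymm (hple (hH hh (hp x)))
      (hple (by simpa using hH (H.inv_mem hh) (hp (h * x))))
  · obtain ⟨_, ⟨v, hv, b, hb, rfl⟩, u, hu, hx⟩ := hp x
    obtain ⟨_, ⟨v', hv', b', hb', rfl⟩, u', hu', hy⟩ := hp y
    -- The inner factors u and v' are absorbed into the ball; each has length at most M, whence the
    -- defect 2M.
    refine hple ⟨v * (b * (u * v') * b'), ⟨v, hv, b * (u * v') * b', ?_, rfl⟩, u', hu', ?_⟩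
    · have h1 := l.mul_le' (b * (u * v')) b'
      have h2 := l.mul_le' b (u * v')
      have h3 := l.mul_le' u v'
      have h4 := hVM u hu
      have h5 := hVM v' hv'
      simp only [mem_ofPred_eq] at hb hb' ⊢
      push_cast
      linarith
    · simp only at hx hy ⊢
      conv_rhs => rw [← hx, ← hy]
      simp only [mul_assoc]
  · obtain ⟨_, ⟨v, hv, b, hb, rfl⟩, u, hu, hx⟩ := hp x
    simp only [mem_ofPred_eq] at hb hx
    have h1 := l.mul_le' (v * b) u
    have h2 := l.mul_le' v b
    have h4 := hVM u hu
    have h5 := hVM v hv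
    rw [hx] at h1
    push_cast
    linarith
  · have h1 : p x ≤ ⌊l.toFun x⌋₊ + 1 := hple (hlW (by exact_mod_cast Nat.lt_floor_add_one _))
    have h2 := Nat.floor_le (l.nonneg' x)
    have h3 : (p x : ℝ) ≤ (⌊l.toFun x⌋₊ : ℝ) + 1 := by exact_mod_cast h1
    linarith

variable (H) in
/-- A locally bounded length function is dominated, up to a constant, by one vanishing on `H`. -/
theorem LengthFunction.exists_pairLengthFunction (l : LengthFunction G) (hl : l.LocallyBounded) :
    ∃ L : PairLengthFunction H, L.LocallyBoundedOnCosets ∧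
      ∃ C : ℝ, 0 ≤ C ∧ ∀ x, l.toFun x ≤ L.toFun x + C := by
  classical
  obtain ⟨p, M, hpm, hinv, hleft, hmul, hlp, hpl⟩ := l.exists_biinvariant H hl
  have hright : ∀ h ∈ H, ∀ x, p (x * h) = p x := fun h hh x => by
    rw [← hinv, mul_inv_rev, hleft _ (H.inv_mem hh), hinv]
  have hHm : MeasurableSet (H : Set G) := (isCompact_coe H).isClosed.measurableSet
  -- Adding M absorbs the defect in the subadditivity of p. Setting q = 0 on H is harmless, since p
  -- is bi-invariant under H.
  let q : G → ℝ := fun x => if x ∈ H then 0 else (p x + M : ℝ)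
  have hq : ∀ {x}, x ∈ H → q x = 0 := fun h => if_pos h
  have hq' : ∀ {x}, x ∉ H → q x = p x + M := fun h => if_neg h
  have hq0 : ∀ x, 0 ≤ q x := fun x => by
    by_cases h : x ∈ H
    · rw [hq h]
    · rw [hq' h]; positivity
  have hqle : ∀ x, q x ≤ p x + M := fun x => by
    by_cases h : x ∈ H
    · rw [hq h]; positivity
    · rw [hq' h]
  let L : PairLengthFunction H :=
    { toFun := q
      measurable' := Measurable.ite hHm measurable_const
        ((measurable_from_top.comp hpm).add_const _)
      nonneg' := hq0
      one' := hq H.one_mem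
      inv' := fun x => by simp only [q, inv_mem_iff, hinv]
      mul_le' := fun x y => by
        by_cases hx : x ∈ H
        · by_cases hy : y ∈ H
          · rw [hq (H.mul_mem hx hy), hq hx, hq hy, add_zero]
          · rw [hq' (fun h => hy ((H.mul_mem_cancel_left hx).1 h)), hq hx, hq' hy, hleft x hx,
              zero_add]
        · by_cases hy : y ∈ H
          · rw [hq' (fun h => hx ((H.mul_mem_cancel_right hy).1 h)), hq hy, hq' hx, hright y hy,
              add_zero]
          · rw [hq' hx, hq' hy]
            have h1 : (p (x * y) : ℝ) ≤ p x + p y + M := by exact_mod_cast hmul x y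
            linarith [hqle (x * y)]
      kernel' := fun h hh => hq hh }
  -- On H the function p is constantly `p 1`, so l is at most `p 1 + M` there; off H, q already
  -- dominates l.
  refine ⟨L, fun K hK => ?_, p 1 + 2 * M, by positivity, fun x => ?_⟩
  · obtain ⟨N, hN⟩ := hl _ (isProperMap_mk.isCompact_preimage hK)
    refine ⟨N + 1 + M, ?_⟩
    rintro _ ⟨a, ha, rfl⟩
    obtain ⟨x, rfl⟩ := mk_surjective a
    have h1 : l.toFun x ≤ N := hN ⟨x, ha, rfl⟩
    have h2 : L.onCosets (CosetSpace.mk H x) = q x := rfl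
    linarith [hqle x, hpl x]
  · have h1 := hlp x
    change _ ≤ q x + _
    by_cases h : x ∈ H
    · have h2 : p x = p 1 := by simpa using hleft x h 1
      rw [hq h]
      rw [h2] at h1
      have : (0 : ℝ) ≤ M := by positivity
      linarith
    · rw [hq' h]
      have h3 : (0 : ℝ) ≤ p 1 := by positivity
      have : (0 : ℝ) ≤ M := by positivity
      linarith

variable {μ : Measure G} [μ.Regular] [μ.IsMulRightInvariant]
  {η : Measure H} [η.Regular] [η.IsMulRightInvariant] [η.IsOpenPosMeasure]
  {ν : Measure (CosetSpace H)} [ν.Regular]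

/-- From l ≤ L + C follows 1 + l ≤ (1 + C)(1 + L); the factor √η(H) comes from integrating over G
instead of H\G. -/
theorem IsWeilMeasure.groupWeightedNorm_comp_mk_le (hν : IsWeilMeasure μ η ν)
    {l : LengthFunction G} {L : PairLengthFunction H} (hL : L.LocallyBoundedOnCosets) {C : ℝ}
    (hC : 0 ≤ C) (hlL : ∀ x, l.toFun x ≤ L.toFun x + C) {s : ℝ} (hs : 0 < s)
    (f : heckeAlgebra H) :
    groupWeightedNorm μ l s (fun x => f.1 (CosetSpace.mk H x)) ≤
      (1 + C) ^ s * Real.sqrt (η.real univ) * weightedNorm ν L s f := by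
  have hm := measureReal_univ_pos η
  have hFc := continuous_comp_mk f
  have hFs := hasCompactSupport_comp_mk f.2.2.1
  have hw0 := L.weight_nonneg (2 * s)
  -- Monotonicity of the integral requires an integrable majorant; L is bounded on the compact
  -- support of the lift of f.
  have hint : Integrable (fun x => ‖f.1 (CosetSpace.mk H x)‖ ^ 2 * (1 + L.toFun x) ^ (2 * s)) μ := by
    obtain ⟨M, hM⟩ := LengthFunction.bddAbove_weight hL.locallyBounded hs hFs
    refine ((integrable_norm_sq hFc hFs).mul_const M).mono'
      (((hFc.norm.pow 2).measurable.mul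
        ((L.measurable'.const_add 1).pow_const _)).aestronglyMeasurable) (.of_forall fun x => ?_)
    rw [Real.norm_of_nonneg (mul_nonneg (sq_nonneg _) (hw0 x))]
    by_cases hx : x ∈ tsupport fun x => f.1 (CosetSpace.mk H x)
    · exact mul_le_mul_of_nonneg_left (hM ⟨x, hx, rfl⟩) (sq_nonneg _)
    · rw [image_eq_zero_of_notMem_tsupport (f := fun x => f.1 (CosetSpace.mk H x)) hx]
      simp
  have h1 : ∫ x, ‖f.1 (CosetSpace.mk H x)‖ ^ 2 * (1 + l.toFun x) ^ (2 * s) ∂μ ≤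
      (1 + C) ^ (2 * s) * (η.real univ * weightedNorm ν L s f ^ 2) := by
    rw [hν.weightedNorm_sq, ← integral_const_mul]
    refine integral_mono_of_nonneg (.of_forall fun x => mul_nonneg (sq_nonneg _)
      (l.weight_nonneg _ x)) (hint.const_mul _) (.of_forall fun x => ?_)
    have h2 := L.nonneg' x
    have h3 := l.nonneg' x
    have h4 : (1 + l.toFun x) ^ (2 * s) ≤ (1 + C) ^ (2 * s) * (1 + L.toFun x) ^ (2 * s) := by
      rw [← Real.mul_rpow (by linarith) (by linarith)]
      exact Real.rpow_le_rpow (by linarith) (by nlinarith [hlL x, mul_nonneg hC h2]) (by linarith)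
    refine (mul_le_mul_of_nonneg_left h4 (sq_nonneg _)).trans_eq ?_
    ring
  have h0 : 0 ≤ (1 + C) ^ s * Real.sqrt (η.real univ) * weightedNorm ν L s f :=
    mul_nonneg (mul_nonneg (Real.rpow_nonneg (by linarith) _) (Real.sqrt_nonneg _))
      (Real.sqrt_nonneg _)
  rw [groupWeightedNorm]
  refine Real.sqrt_le_iff.2 ⟨h0, h1.trans_eq ?_⟩
  rw [mul_pow, mul_pow, Real.sq_sqrt hm.le, mul_comm 2 s, Real.rpow_mul (by linarith),
    Real.rpow_two, mul_assoc]

/-- Apply (RD) of G to the lift of f. Its weighted norm is controlled through L, and the operator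
bound is divided by η(H) on the way down. -/
theorem IsWeilMeasure.pairHasRD_of_groupHasRD (hν : IsWeilMeasure μ η ν) (h : GroupHasRD μ) :
    PairHasRD ν := by
  obtain ⟨l, hl, s, c, hs, hc, hRD⟩ := h
  obtain ⟨L, hL, C, hC, hlL⟩ := l.exists_pairLengthFunction H hl
  have hm := measureReal_univ_pos η
  refine ⟨L, hL, s, c * ((1 + C) ^ s * Real.sqrt (η.real univ)) / η.real univ, hs, by positivity,
    fun f => ?_⟩
  obtain ⟨T, hT, hTn⟩ := hRD _ (continuous_comp_mk f) (hasCompactSupport_comp_mk f.2.2.1)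
  have hb := hν.kernelBound_convolutionKernel f (IsKernelOperator.kernelBound
    (isProperKernel_groupKernel (continuous_comp_mk f) (hasCompactSupport_comp_mk f.2.2.1)) hT hTn)
  obtain ⟨S, hS, hSn⟩ := KernelBound.exists_operator
    (div_nonneg (mul_nonneg hc.le (Real.sqrt_nonneg _)) hm.le)
    (isProperKernel_convolutionKernel f) hb
  refine ⟨S, hS, hSn.trans ?_⟩
  rw [div_mul_eq_mul_div, mul_assoc c]
  gcongr
  exact hν.groupWeightedNorm_comp_mk_le hL hC hlL hs f

end

end HeckePair

end

theorem mainTheorem1 {G : Type*} [Group G] [TopologicalSpace G] [IsTopologicalGroup G]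
    [LocallyCompactSpace G] [T2Space G] [MeasurableSpace G] [BorelSpace G]
    (H : Subgroup G) [CompactSpace H]
    (μ : Measure G) [μ.Regular] [μ.IsMulRightInvariant] [μ.IsOpenPosMeasure]
    (η : Measure H) [η.Regular] [η.IsMulRightInvariant] [η.IsOpenPosMeasure]
    (ν : Measure (HeckePair.CosetSpace H)) [ν.Regular]
    (hν : HeckePair.IsWeilMeasure μ η ν) :
    HeckePair.IsHeckePair H ν ∧ (HeckePair.GroupHasRD μ ↔ HeckePair.PairHasRD ν) :=
  ⟨hν.isHeckePair, hν.pairHasRD_of_groupHasRD, hν.groupHasRD_of_pairHasRD⟩
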